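/- **Setting.** Let $d,n,p\ge 1$ be integers and let $f:[0,1]^d\times\mathbb R^p\to\mathbb R$, $(x,\theta)\mapsto f(x;\theta)$, be a loss function for which there are $L_1,L_2,\eta,\mu>0$ such that: (1) for every $x\in[0,1]^d$ the map $f(x;\cdot)$ is differentiable and $\|\nabla_\theta f(x;\theta_1)-\nabla_\theta f(x;\theta_2)\|_2\le L_1\|\theta_1-\theta_2\|_2$ for all $\theta_1,\theta_2\in\mathbb R^p$; (2) for every $\theta\in\mathbb R^p$ and $i\in\{1,\dots,p\}$ the function $g_i(\cdot;\theta)=\frac{\partial f}{\partial\theta_i}(\cdot;\theta):[0,1]^d\to\mathbb R$ is $l=\lceil\eta\rceil-1$ times differentiable and $|\nabla^s g_i(y_1;\theta)-\nabla^s g_i(y_2;\theta)|\le L_2\|y_1-y_2\|_1^{\eta-l}$ for all $y_1,y_2\in[0,1]^d$ and all multi-indices $s$ with $|s|=l$; (3) for every $x\in[0,1]^d$, $f(x;\theta_1)\ge f(x;\theta_2)+\nabla_\theta f(x;\theta_2)^{\mathrm T}(\theta_1-\theta_2)+\frac{\mu}{2}\|\theta_1-\theta_2\|_2^2$ for all $\theta_1,\theta_2\in\mathbb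 R^p$. Assume that $l\ge d\ge 19$ and $\sigma=L_1/\mu>1$. Let $c\ge b>0$ and let $K:\mathbb R\to\mathbb R$ satisfy $b\le K\le c$ on $[-1,1]$ and $K=0$ off $[-1,1]$. Put $$\Lambda=\Lambda(d,l)=\Big(\frac{\pi d}{8e^2}\Big)^{dN}(N-1)^{N-1}(l+d)^{-3l\left(\frac{e(l+d)}{d}\right)^d},\qquad N=\Big(\frac{l+d}{d}\Big)^d,\qquad h'=\frac{2b}{55(2L_2+1)c}\cdot\frac{\Lambda l}{d}.$$ Given training data $x^{(1)},\dots,x^{(n)}\in[h',1-h']^d$, let $F(\theta)=\frac1n\sum_{j=1}^n f(x^{(j)};\theta)$ and $F_*=\inf_{\theta\in\mathbb R^p}F(\theta)$ (which is finite). **Algorithm (LPI-GD).** Given $\delta>0$, let $$m=\Big\lceil\frac{110(2L_2+1)c}{b}\cdot\frac{d(3e)^d}{\Lambda^2}\,\delta^{-1/\eta}\Big\rceil,\qquad h=\frac{4l(3e)^d}{m\Lambda},\qquad \mathcal G_m=\{1/m,2/m,\dots,1\}^d,$$ let $U(u)=[u^s/s!:\ s\in\mathbb Z_{\ge0}^d,\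 |s|\le l]$ for $u\in\mathbb R^d$, and let $$B(x)=\frac1{(mh)^d}\sum_{y\in\mathcal G_m}U\Big(\frac{y-x}{h}\Big)U\Big(\frac{y-x}{h}\Big)^{\mathrm T}\prod_{j=1}^dK\Big(\frac{y_j-x_j}{h}\Big).$$ Let $w_y^*(x)$ be the coordinate with index $s=0$ of $\frac1{(mh)^d}\big(\prod_{j}K(\frac{y_j-x_j}{h})\big)B(x)^{-1}U(\frac{y-x}{h})$. From an arbitrary $\theta^{(0)}\in\mathbb R^p$ the algorithm with constant approximation error $\delta$ performs, for $t\ge 1$, the updates $$\theta^{(t)}=\theta^{(t-1)}-\frac1{L_1}\cdot\frac1n\sum_{j=1}^n\ \sum_{y\in\mathcal G_m}w_y^*(x^{(j)})\,\nabla_\theta f(y;\theta^{(t-1)}).$$ **Statement.** Let $\varepsilon>0$, let $$T=\left\lceil\Big(\log\frac{\sigma}{\sigma-1}\Big)^{-1}\log\left(\frac{F(\theta^{(0)})-F_*+\frac{p}{2\mu}}{\varepsilon}\right)\right\rceil$$ (read as $0$ if this integer is negative), and let $\delta=(1-1/\sigma)^{T/2}$, so that $\delta^2=(1-1/\sigma)^T$.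 Then, after $T$ iterations of LPI-GD with constant approximation error $\delta$, the vector $\theta^{(T)}$ is an $\varepsilon$-approximate minimizer of $F$: $$F(\theta^{(T)})-F_*\le\varepsilon.$$ Moreover, if $\varepsilon<F(\theta^{(0)})-F_*+\frac{p}{2\mu}$, then $T\ge1$, $\delta\in(0,1)$, and $\delta^2=\Theta(\varepsilon/p)$ when $F(\theta^{(0)})-F_*=O(p)$; that is, for every $M\ge0$ there are constants $C_1,C_2>0$ depending only on $\mu,L_1,M$ such that, in every such problem instance, $\delta^2\le C_2\,\varepsilon/p$, and $C_1\,\varepsilon/p\le\delta^2$ whenever $F(\theta^{(0)})-F_*\le Mp$. -/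

import Mathlib

namespace LPIGD

noncomputable section

/-- The data hypercube `[0,1]^d`. -/
def cube (d : ℕ) : Set (Fin d → ℝ) := Set.Icc 0 1

/-- The order `l = ⌈η⌉ - 1` attached to a Hölder exponent `η > 0`. -/
def order (η : ℝ) : ℕ := ⌈η⌉₊ - 1

/-- The `k`-th order partial derivative `∂^k g / ∂x_{i 0} ⋯ ∂x_{i (k-1)}` on `[0,1]^d` (one-sided
on the boundary). As `i` runs through all sequences of length `k`, these are the
partial derivatives `∇^s g` with multi-index `s`, `|s| = k`, where `s_j` counts how often `j`
occurs in `i`. -/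
def mixedPartial {d : ℕ} (k : ℕ) (i : Fin k → Fin d) (g : (Fin d → ℝ) → ℝ) (y : Fin d → ℝ) : ℝ :=
  iteratedFDerivWithin ℝ k g (cube d) y (fun j => Pi.single (i j) (1 : ℝ))

/-- The `(η, L)`-Hölder class on `[0,1]^d`: `g` is `l = ⌈η⌉ - 1` times differentiable on `[0,1]^d`
and all partial derivatives of order `l` are `(η - l)`-Hölder with constant `L` with respect to the
`ℓ¹`-norm. -/
structure HolderClass {d : ℕ} (η L : ℝ) (g : (Fin d → ℝ) → ℝ) : Prop where
  differentiable : ∀ k < order η,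
    DifferentiableOn ℝ (iteratedFDerivWithin ℝ k g (cube d)) (cube d)
  holder : ∀ i : Fin (order η) → Fin d, ∀ y₁ ∈ cube d, ∀ y₂ ∈ cube d,
    |mixedPartial (order η) i g y₁ - mixedPartial (order η) i g y₂|
      ≤ L * (∑ j, |y₁ j - y₂ j|) ^ (η - (order η : ℝ))

/-- The first order oracle `O(x, θ) = ∇_θ f(x; θ)`. -/
def oracle {d p : ℕ} (f : (Fin d → ℝ) → EuclideanSpace ℝ (Fin p) → ℝ)
    (x : Fin d → ℝ) (θ : EuclideanSpace ℝ (Fin p)) : EuclideanSpace ℝ (Fin p) :=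
  gradient (f x) θ

/-- The assumptions on the loss function `f : [0,1]^d × ℝ^p → ℝ` (values of `f` at data points
outside `[0,1]^d` play no role). -/
structure LossAssumptions {d p : ℕ} (f : (Fin d → ℝ) → EuclideanSpace ℝ (Fin p) → ℝ)
    (L₁ L₂ η μ : ℝ) : Prop where
  differentiable : ∀ x ∈ cube d, Differentiable ℝ (f x)
  lipschitz_gradient : ∀ x ∈ cube d, ∀ θ₁ θ₂ : EuclideanSpace ℝ (Fin p),
    ‖gradient (f x) θ₁ - gradient (f x) θ₂‖ ≤ L₁ * ‖θ₁ - θ₂‖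
  holder_in_data : ∀ (θ : EuclideanSpace ℝ (Fin p)) (i : Fin p),
    HolderClass η L₂ (fun x => gradient (f x) θ i)
  strongly_convex : ∀ x ∈ cube d, ∀ θ₁ θ₂ : EuclideanSpace ℝ (Fin p),
    f x θ₂ + inner ℝ (gradient (f x) θ₂) (θ₁ - θ₂) + μ / 2 * ‖θ₁ - θ₂‖ ^ 2 ≤ f x θ₁

/-- The ERM objective `F(θ) = (1/n) ∑ⱼ f(x⁽ʲ⁾; θ)`. -/
def erm {d p n : ℕ} (f : (Fin d → ℝ) → EuclideanSpace ℝ (Fin p) → ℝ) (x : Fin n → Fin d → ℝ)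
    (θ : EuclideanSpace ℝ (Fin p)) : ℝ :=
  1 / (n : ℝ) * ∑ j, f (x j) θ

/-- The infimum `F_*` of the ERM objective. -/
def ermInf {d p n : ℕ} (f : (Fin d → ℝ) → EuclideanSpace ℝ (Fin p) → ℝ)
    (x : Fin n → Fin d → ℝ) : ℝ :=
  ⨅ θ, erm f x θ

/-- The kernel `K : ℝ → [0,c]` has support `[-1,1]` and takes values in `[b,c]` there. -/
structure IsKernel (K : ℝ → ℝ) (b c : ℝ) : Prop where
  mem_Icc : ∀ u ∈ Set.Icc (-1 : ℝ) 1, K u ∈ Set.Icc b c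
  eq_zero : ∀ u ∉ Set.Icc (-1 : ℝ) 1, K u = 0

/-- The constant `Λ(d,l)`. -/
def Lam (d l : ℕ) : ℝ :=
  (Real.pi * d / (8 * Real.exp 1 ^ 2)) ^ ((d : ℝ) * (((l : ℝ) + d) / d) ^ d)
    * ((((l : ℝ) + d) / d) ^ d - 1) ^ ((((l : ℝ) + d) / d) ^ d - 1)
    * (1 / ((l : ℝ) + d) ^ (3 * (l : ℝ) * (Real.exp 1 * ((l : ℝ) + d) / d) ^ d))

/-- Multi-indices `s ∈ ℤ₊^d` with `|s| ≤ l`. -/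
abbrev MultiIndex (d l : ℕ) : Type := {s : Fin d → Fin (l + 1) // ∑ i, (s i : ℕ) ≤ l}

/-- The zero multi-index, which is the first one in lexicographical order. -/
def zeroIndex (d l : ℕ) : MultiIndex d l := ⟨fun _ => 0, by simp⟩

/-- The vector `U(u) = [u^s / s! : |s| ≤ l]`. -/
def U {d : ℕ} (l : ℕ) (u : Fin d → ℝ) : MultiIndex d l → ℝ :=
  fun s => (∏ i, u i ^ (s.1 i : ℕ)) / ∏ i, (Nat.factorial (s.1 i : ℕ) : ℝ)

/-- The points of the uniform grid `G_m = {1/m, 2/m, …, 1}^d`, enumerated by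
`k ∈ {0, …, m-1}^d`. -/
def gridPoint {d m : ℕ} (k : Fin d → Fin m) : Fin d → ℝ := fun i => ((k i : ℕ) + 1 : ℝ) / m

/-- The product kernel `∏ⱼ K((y_j - x_j) / h)`. -/
def prodKernel {d : ℕ} (K : ℝ → ℝ) (h : ℝ) (x y : Fin d → ℝ) : ℝ := ∏ j, K ((y j - x j) / h)

/-- The matrix `B(x)` of the weighted regression problem. -/
def B {d : ℕ} (K : ℝ → ℝ) (l m : ℕ) (h : ℝ) (x : Fin d → ℝ) :
    Matrix (MultiIndex d l) (MultiIndex d l) ℝ :=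
  (1 / ((m : ℝ) * h) ^ d) • ∑ k : Fin d → Fin m,
    prodKernel K h x (gridPoint k) •
      Matrix.vecMulVec (U l (fun i => (gridPoint k i - x i) / h))
        (U l (fun i => (gridPoint k i - x i) / h))

/-- The vector-valued weights `w_y(x)`, `y = gridPoint k`. -/
def vecWeight {d : ℕ} (K : ℝ → ℝ) (l m : ℕ) (h : ℝ) (x : Fin d → ℝ) (k : Fin d → Fin m) :
    MultiIndex d l → ℝ :=
  (1 / ((m : ℝ) * h) ^ d * prodKernel K h x (gridPoint k)) •
    (B K l m h x)⁻¹.mulVec (U l (fun i => (gridPoint k i - x i) / h))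

/-- The interpolation weights `w*_y(x)`: the first coordinates of the vector-valued weights. -/
def weight {d : ℕ} (K : ℝ → ℝ) (l m : ℕ) (h : ℝ) (x : Fin d → ℝ) (k : Fin d → Fin m) : ℝ :=
  vecWeight K l m h x k (zeroIndex d l)

/-- The local polynomial interpolator of order `l` of `g`, evaluated at `x`. -/
def interpolator {d : ℕ} (K : ℝ → ℝ) (l m : ℕ) (h : ℝ) (g : (Fin d → ℝ) → ℝ) (x : Fin d → ℝ) : ℝ :=
  ∑ k : Fin d → Fin m, g (gridPoint k) * weight K l m h x k

/-- The grid size `m` for supremum norm approximation error `δ`. -/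
def gridSize (d : ℕ) (η L₂ b c δ : ℝ) : ℕ :=
  ⌈110 * (2 * L₂ + 1) * c / b * (d * (3 * Real.exp 1) ^ d / Lam d (order η) ^ 2)
    * (1 / δ) ^ (1 / η)⌉₊

/-- The bandwidth `h` attached to the grid size `m`. -/
def bandwidth (d l m : ℕ) : ℝ := 4 * (l : ℝ) * (3 * Real.exp 1) ^ d / (m * Lam d l)

/-- The margin `h'`: the training data lie in `[h', 1 - h']^d`. -/
def margin (d : ℕ) (η L₂ b c : ℝ) : ℝ :=
  2 * b / (55 * (2 * L₂ + 1) * c) * (Lam d (order η) * (order η : ℝ) / d)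

/-- The estimate of `∇F(θ)` obtained by interpolating, from the oracle answers on the grid, the
partial derivatives at the training data and averaging, with approximation error `δ`. -/
def gradEstimate {d p n : ℕ}
    (O : (Fin d → ℝ) → EuclideanSpace ℝ (Fin p) → EuclideanSpace ℝ (Fin p))
    (x : Fin n → Fin d → ℝ) (K : ℝ → ℝ) (η L₂ b c δ : ℝ)
    (θ : EuclideanSpace ℝ (Fin p)) : EuclideanSpace ℝ (Fin p) :=
  WithLp.toLp 2 fun i => 1 / (n : ℝ) * ∑ j,
    interpolator K (order η) (gridSize d η L₂ b c δ)
      (bandwidth d (order η) (gridSize d η L₂ b c δ)) (fun y => O y θ i) (x j)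

/-- The iterates `θ⁽ᵗ⁾` of LPI-GD with oracle `O`, training data `x`, kernel `K`, approximation
errors `δ t` at iteration `t ≥ 1`, step size `1 / L₁` and initialization `θ₀`. -/
def lpigd {d p n : ℕ}
    (O : (Fin d → ℝ) → EuclideanSpace ℝ (Fin p) → EuclideanSpace ℝ (Fin p))
    (x : Fin n → Fin d → ℝ) (K : ℝ → ℝ) (L₁ L₂ η b c : ℝ) (δ : ℕ → ℝ)
    (θ₀ : EuclideanSpace ℝ (Fin p)) : ℕ → EuclideanSpace ℝ (Fin p)
  | 0 => θ₀
  | t + 1 =>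
    lpigd O x K L₁ L₂ η b c δ θ₀ t -
      (1 / L₁) • gradEstimate O x K η L₂ b c (δ (t + 1)) (lpigd O x K L₁ L₂ η b c δ θ₀ t)

/-- The number of iterations
`T = ⌈(log (σ / (σ - 1)))⁻¹ log ((gap + p / (2 μ)) / ε)⌉` with `σ = L₁ / μ` and
`gap = F(θ⁽⁰⁾) - F_*`; it is set to `0` if this integer is negative. -/
def numIter (p : ℕ) (μ L₁ gap ε : ℝ) : ℕ :=
  ⌈(Real.log (L₁ / μ / (L₁ / μ - 1)))⁻¹ * Real.log ((gap + p / (2 * μ)) / ε)⌉₊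

/-- The approximation error `δ = (1 - 1/σ)^(T/2)`. -/
def approxError (σ : ℝ) (T : ℕ) : ℝ := (1 - 1 / σ) ^ ((T : ℝ) / 2)

end

end LPIGD

/-! Write `r = 1 - 1/σ`. A gradient step of length `1/L₁` on the strongly convex objective contracts
the optimality gap by `r`, up to half the squared gradient error divided by `L₁`. If every
interpolated partial derivative is `δ`-accurate, that squared error is at most `p δ²`, and summing
the geometric series gives the bound `r^T gap + p δ²/(2μ)`. With `δ² = r^T` this is `r^T (gap +
p/(2μ))`, and `T` is the least exponent bringing it below `ε`. Minimality of `T` costs at most one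
factor `r`, whence `δ² = Θ(ε/p)`.

The remaining work is the `δ`-accuracy, `interpolation_error_le`. The weights reproduce polynomials
of degree at most `l`, so the error is at most the Taylor remainder `L₂ (d h)^η` times the `ℓ¹`-norm
of the weights. By Cauchy–Schwarz the square of this norm is at most the total kernel mass times the
`(0,0)` entry of `B⁻¹` (`sum_abs_weight_sq_le`). That entry is bounded without eigenvalues: Lagrange
extrapolation to the origin from a tensor grid inside the kernel window controls the constant
coefficient of a polynomial by its grid values (`coeff_zero_sq_le`). The resulting powers of `l` and
`d` are absorbed by `Λ`, which is small enough that `Λ (l+d)^(5l(d+1)) ≤ 1`. -/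

namespace LPIGD

/-! ### Gradient descent with inexact gradients -/

section GradientDescent

variable {E : Type*} [NormedAddCommGroup E] [InnerProductSpace ℝ E] [CompleteSpace E]

/-- The descent lemma for functions with Lipschitz continuous gradient. -/
theorem le_add_inner_gradient_add {F : E → ℝ} {L : ℝ} (hF : Differentiable ℝ F)
    (hL : ∀ u v, ‖gradient F u - gradient F v‖ ≤ L * ‖u - v‖) (u v : E) :
    F (u + v) ≤ F u + inner ℝ (gradient F u) v + L / 2 * ‖v‖ ^ 2 := by
  -- `F` along the segment minus its quadratic model is antitone on `[0,1]`; the claim compares its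
  -- values at 0 and 1.
  have hd : ∀ t : ℝ, HasDerivAt
      (fun t : ℝ => F (u + t • v) - t * inner ℝ (gradient F u) v - L / 2 * t ^ 2 * ‖v‖ ^ 2)
      (inner ℝ (gradient F (u + t • v)) v - inner ℝ (gradient F u) v - L * t * ‖v‖ ^ 2) t := by
    intro t
    have h1 : HasDerivAt (fun t : ℝ => u + t • v) v t := by
      simpa using ((hasDerivAt_id t).smul_const v).const_add u
    have h2 : HasDerivAt (fun t : ℝ => F (u + t • v)) (inner ℝ (gradient F (u + t • v)) v) t := by
      have := (hF (u + t • v)).hasGradientAt.hasFDerivAt.comp_hasDerivAt t h1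
      simpa [Function.comp_def] using this
    have h3 : HasDerivAt (fun t : ℝ => t * inner ℝ (gradient F u) v)
        (inner ℝ (gradient F u) v) t := by
      simpa using (hasDerivAt_id t).mul_const (inner ℝ (gradient F u) v)
    have h4 : HasDerivAt (fun t : ℝ => L / 2 * t ^ 2 * ‖v‖ ^ 2) (L * t * ‖v‖ ^ 2) t := by
      have := (((hasDerivAt_id t).pow 2).const_mul (L / 2)).mul_const (‖v‖ ^ 2)
      refine this.congr_deriv ?_
      simp only [id]; push_cast; ring
    exact (h2.sub h3).sub h4
  have hanti := antitoneOn_of_deriv_nonpos (convex_Icc (0 : ℝ) 1)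
    (fun t _ => (hd t).continuousAt.continuousWithinAt)
    (fun t _ => (hd t).differentiableAt.differentiableWithinAt)
    (fun t ht => by
      rw [interior_Icc] at ht
      rw [(hd t).deriv, ← inner_sub_left]
      have h1 := real_inner_le_norm (gradient F (u + t • v) - gradient F u) v
      have h2 := hL (u + t • v) u
      rw [add_sub_cancel_left, norm_smul, Real.norm_of_nonneg ht.1.le] at h2
      have h3 := mul_le_mul_of_nonneg_right h2 (norm_nonneg v)
      nlinarith)
  have := hanti (Set.left_mem_Icc.2 zero_le_one) (Set.right_mem_Icc.2 zero_le_one) zero_le_one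
  simp only [one_smul, zero_smul, add_zero] at this
  linarith

/-- The lower bound on a strongly convex function which gives the Polyak–Łojasiewicz inequality. -/
theorem sub_norm_gradient_sq_le {F : E → ℝ} {μ : ℝ} (hμ : 0 < μ)
    (hc : ∀ u v, F v + inner ℝ (gradient F v) (u - v) + μ / 2 * ‖u - v‖ ^ 2 ≤ F u) (u v : E) :
    F v - ‖gradient F v‖ ^ 2 / (2 * μ) ≤ F u := by
  refine le_trans ?_ (hc u v)
  have h1 := abs_le.1 (abs_real_inner_le_norm (gradient F v) (u - v))
  -- Completing the square in `‖u - v‖`.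
  have h2 : 0 ≤ (‖gradient F v‖ - μ * ‖u - v‖) ^ 2 / (2 * μ) := by positivity
  have h3 : (‖gradient F v‖ - μ * ‖u - v‖) ^ 2 / (2 * μ) = ‖gradient F v‖ ^ 2 / (2 * μ)
      - ‖gradient F v‖ * ‖u - v‖ + μ / 2 * ‖u - v‖ ^ 2 := by field_simp; ring
  linarith [h1.1]

/-- One step of gradient descent with an inexact gradient `v`. -/
theorem inexact_gradient_step {F : E → ℝ} {L μ m e : ℝ} (hLpos : 0 < L) (hμ : 0 < μ)
    (hF : Differentiable ℝ F)
    (hL : ∀ u v, ‖gradient F u - gradient F v‖ ≤ L * ‖u - v‖) (u v : E)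
    (hm : F u - ‖gradient F u‖ ^ 2 / (2 * μ) ≤ m) (he : ‖v - gradient F u‖ ^ 2 ≤ e) :
    F (u - (1 / L) • v) - m ≤ (1 - 1 / (L / μ)) * (F u - m) + e / (2 * L) := by
  have h := le_add_inner_gradient_add hF hL u (-((1 / L) • v))
  rw [← sub_eq_add_neg, norm_neg, norm_smul, inner_neg_right, inner_smul_right,
    Real.norm_of_nonneg (by positivity)] at h
  have hs := norm_sub_sq_real v (gradient F u)
  rw [real_inner_comm] at hs
  set a := inner ℝ (gradient F u) v
  -- The step `1/L` makes the change of the model `‖v‖² - 2⟨∇F, v⟩ = ‖v - ∇F‖² - ‖∇F‖²` over `2L`: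
  -- only the error of `v` enters, with no cross term.
  have h1 : F u + -(1 / L * a) + L / 2 * (1 / L * ‖v‖) ^ 2
      = F u + (‖v‖ ^ 2 - 2 * a) / (2 * L) := by field_simp; ring
  have h2 : ‖v‖ ^ 2 - 2 * a ≤ e - ‖gradient F u‖ ^ 2 := by linarith
  have h3 : 2 * μ * (F u - m) ≤ ‖gradient F u‖ ^ 2 := by
    have : F u - m ≤ ‖gradient F u‖ ^ 2 / (2 * μ) := by linarith
    rwa [le_div_iff₀' (by positivity)] at this
  have h4 : (‖v‖ ^ 2 - 2 * a) / (2 * L) ≤ (e - 2 * μ * (F u - m)) / (2 * L) := by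
    exact div_le_div_of_nonneg_right (by linarith) (by positivity)
  have h5 : (e - 2 * μ * (F u - m)) / (2 * L) = e / (2 * L) - 1 / (L / μ) * (F u - m) := by
    field_simp
  linarith

end GradientDescent

/-- Solution of the recursion `a (t + 1) ≤ r a t + e`. -/
theorem le_pow_mul_add_of_recursion {a : ℕ → ℝ} {r e : ℝ} (hr0 : 0 ≤ r) (hr1 : r < 1)
    (he : 0 ≤ e) (h : ∀ t, a (t + 1) ≤ r * a t + e) (t : ℕ) :
    a t ≤ r ^ t * a 0 + e / (1 - r) := by
  have h1 : 0 < 1 - r := by linarith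
  induction t with
  | zero => have : 0 ≤ e / (1 - r) := by positivity
            simp; linarith
  | succ t ih =>
    -- `e / (1 - r)` is the fixed point of `a ↦ r a + e`.
    have h2 : r * (e / (1 - r)) + e = e / (1 - r) := by field_simp; ring
    calc a (t + 1) ≤ r * a t + e := h t
      _ ≤ r * (r ^ t * a 0 + e / (1 - r)) + e := by gcongr
      _ = _ := by rw [mul_add, add_assoc, h2]; ring

/-! ### The number of iterations and the accuracy `δ` -/

section Iterations

variable {p : ℕ} {μ L₁ gap ε : ℝ}

theorem contraction_mem (hσ : 1 < L₁ / μ) : 1 - 1 / (L₁ / μ) ∈ Set.Ioo (0 : ℝ) 1 := by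
  have h1 : 1 / (L₁ / μ) < 1 := by rw [div_lt_one (by linarith)]; exact hσ
  have h2 : 0 < 1 / (L₁ / μ) := by positivity
  exact ⟨by linarith, by linarith⟩

/-- `σ/(σ-1)` is the reciprocal of the contraction factor, so `T` is a rounded logarithm to the base
of that factor. -/
theorem log_ratio_eq (hσ : 1 < L₁ / μ) :
    Real.log (L₁ / μ / (L₁ / μ - 1)) = -Real.log (1 - 1 / (L₁ / μ)) := by
  rw [← Real.log_inv]
  congr 1
  have : L₁ / μ - 1 ≠ 0 := by linarith
  have : L₁ / μ ≠ 0 := by linarith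
  generalize L₁ / μ = s at *
  field_simp

theorem approxError_sq (hσ : 1 < L₁ / μ) (T : ℕ) :
    approxError (L₁ / μ) T ^ 2 = (1 - 1 / (L₁ / μ)) ^ T := by
  rw [approxError, ← Real.rpow_natCast, ← Real.rpow_mul (contraction_mem hσ).1.le]
  simp

/-- `T` is large enough. -/
theorem pow_numIter_mul_le (hσ : 1 < L₁ / μ) (hε : 0 < ε) (hg : 0 < gap + p / (2 * μ)) :
    (1 - 1 / (L₁ / μ)) ^ numIter p μ L₁ gap ε * (gap + p / (2 * μ)) ≤ ε := by
  obtain ⟨h0, h1⟩ := contraction_mem hσ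
  have hlog : Real.log (1 - 1 / (L₁ / μ)) < 0 := Real.log_neg h0 h1
  have hT := Nat.le_ceil
    ((Real.log (L₁ / μ / (L₁ / μ - 1)))⁻¹ * Real.log ((gap + p / (2 * μ)) / ε))
  rw [← numIter, log_ratio_eq hσ, inv_mul_le_iff₀ (by linarith)] at hT
  rw [← le_div_iff₀ hg, ← Real.log_le_log_iff (by positivity) (by positivity), Real.log_pow,
    ← inv_div _ ε, Real.log_inv]
  linarith

/-- `T` is not too large. -/
theorem le_pow_numIter_mul (hσ : 1 < L₁ / μ) (hε : 0 < ε) (hg : ε < gap + p / (2 * μ)) :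
    (1 - 1 / (L₁ / μ)) * ε ≤
      (1 - 1 / (L₁ / μ)) ^ numIter p μ L₁ gap ε * (gap + p / (2 * μ)) := by
  obtain ⟨h0, h1⟩ := contraction_mem hσ
  have hg0 : 0 < gap + p / (2 * μ) := hε.trans hg
  have hlog : Real.log (1 - 1 / (L₁ / μ)) < 0 := Real.log_neg h0 h1
  have hq : 0 < Real.log ((gap + p / (2 * μ)) / ε) := Real.log_pos ((one_lt_div hε).2 hg)
  -- Rounding up adds less than one iteration, hence the single extra factor `1 - 1/σ`. The
  -- natural-number ceiling needs a nonnegative argument, which `hg` provides.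
  have hT := Nat.ceil_lt_add_one (a := (Real.log (L₁ / μ / (L₁ / μ - 1)))⁻¹ *
    Real.log ((gap + p / (2 * μ)) / ε)) (by
      rw [log_ratio_eq hσ]
      have : 0 < -Real.log (1 - 1 / (L₁ / μ)) := by linarith
      positivity)
  rw [← numIter, log_ratio_eq hσ, ← sub_lt_iff_lt_add, lt_inv_mul_iff₀ (by linarith)] at hT
  rw [← div_le_iff₀ hg0, ← Real.log_le_log_iff (by positivity) (by positivity), Real.log_pow,
    mul_div_assoc, Real.log_mul h0.ne' (by positivity), ← inv_div _ ε,
    Real.log_inv]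
  linarith

theorem one_le_numIter (hσ : 1 < L₁ / μ) (hε : 0 < ε) (hg : ε < gap + p / (2 * μ)) :
    1 ≤ numIter p μ L₁ gap ε := by
  have hlog : Real.log (1 - 1 / (L₁ / μ)) < 0 :=
    Real.log_neg (contraction_mem hσ).1 (contraction_mem hσ).2
  have hq : 0 < Real.log ((gap + p / (2 * μ)) / ε) := Real.log_pos ((one_lt_div hε).2 hg)
  refine Nat.one_le_ceil_iff.2 ?_
  rw [log_ratio_eq hσ]
  have : 0 < -Real.log (1 - 1 / (L₁ / μ)) := by linarith
  positivity

theorem approxError_mem_Ioo (hσ : 1 < L₁ / μ) {T : ℕ} (hT : 1 ≤ T) :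
    approxError (L₁ / μ) T ∈ Set.Ioo (0 : ℝ) 1 := by
  obtain ⟨h0, h1⟩ := contraction_mem hσ
  have : (1 : ℝ) ≤ T := by exact_mod_cast hT
  exact ⟨Real.rpow_pos_of_pos h0 _, Real.rpow_lt_one h0.le h1 (by positivity)⟩

end Iterations

/-! ### The averaged objective and convergence given accurate interpolation -/

section ERM

variable {d p n : ℕ} {f : (Fin d → ℝ) → EuclideanSpace ℝ (Fin p) → ℝ} {x : Fin n → Fin d → ℝ}
  {L₁ L₂ η μ : ℝ}

theorem hasGradientAt_erm (hf : LossAssumptions f L₁ L₂ η μ) (hx : ∀ j, x j ∈ cube d)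
    (θ : EuclideanSpace ℝ (Fin p)) :
    HasGradientAt (erm f x) ((1 / (n : ℝ)) • ∑ j, gradient (f (x j)) θ) θ := by
  rw [hasGradientAt_iff_hasFDerivAt]
  have h : ∀ j ∈ Finset.univ, HasFDerivAt (f (x j))
      (InnerProductSpace.toDual ℝ _ (gradient (f (x j)) θ)) θ := fun j _ =>
    (hf.differentiable (x j) (hx j) θ).hasGradientAt.hasFDerivAt
  have := (HasFDerivAt.fun_sum h).const_mul (1 / (n : ℝ))
  rw [map_smulₛₗ, map_sum]
  exact this

theorem gradient_erm (hf : LossAssumptions f L₁ L₂ η μ) (hx : ∀ j, x j ∈ cube d)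
    (θ : EuclideanSpace ℝ (Fin p)) :
    gradient (erm f x) θ = (1 / (n : ℝ)) • ∑ j, gradient (f (x j)) θ :=
  (hasGradientAt_erm hf hx θ).gradient

theorem differentiable_erm (hf : LossAssumptions f L₁ L₂ η μ) (hx : ∀ j, x j ∈ cube d) :
    Differentiable ℝ (erm f x) :=
  fun θ => (hasGradientAt_erm hf hx θ).differentiableAt

theorem lipschitz_gradient_erm (hn : 1 ≤ n) (hf : LossAssumptions f L₁ L₂ η μ)
    (hx : ∀ j, x j ∈ cube d) (u v : EuclideanSpace ℝ (Fin p)) :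
    ‖gradient (erm f x) u - gradient (erm f x) v‖ ≤ L₁ * ‖u - v‖ := by
  have hn' : (0 : ℝ) < n := by exact_mod_cast hn
  rw [gradient_erm hf hx, gradient_erm hf hx, ← smul_sub, ← Finset.sum_sub_distrib, norm_smul,
    Real.norm_of_nonneg (by positivity)]
  have : ‖∑ j, (gradient (f (x j)) u - gradient (f (x j)) v)‖ ≤ ∑ _j : Fin n, L₁ * ‖u - v‖ :=
    norm_sum_le_of_le _ fun j _ => hf.lipschitz_gradient (x j) (hx j) u v
  rw [Finset.sum_const, Finset.card_univ, Fintype.card_fin, nsmul_eq_mul] at this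
  rw [one_div, inv_mul_le_iff₀ hn']
  exact this

theorem strongly_convex_erm (hn : 1 ≤ n) (hf : LossAssumptions f L₁ L₂ η μ)
    (hx : ∀ j, x j ∈ cube d) (u v : EuclideanSpace ℝ (Fin p)) :
    erm f x v + inner ℝ (gradient (erm f x) v) (u - v) + μ / 2 * ‖u - v‖ ^ 2 ≤ erm f x u := by
  have hn' : (0 : ℝ) < n := by exact_mod_cast hn
  have h := Finset.sum_le_sum fun j (_ : j ∈ Finset.univ) =>
    hf.strongly_convex (x j) (hx j) u v
  simp only [Finset.sum_add_distrib, Finset.sum_const, Finset.card_univ, Fintype.card_fin,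
    nsmul_eq_mul] at h
  rw [gradient_erm hf hx, inner_smul_left, sum_inner, erm, erm]
  simp only [conj_trivial]
  have h2 := mul_le_mul_of_nonneg_left h (show 0 ≤ 1 / (n : ℝ) by positivity)
  refine le_trans (le_of_eq ?_) h2
  field_simp

theorem bddBelow_erm (hμ : 0 < μ) (hn : 1 ≤ n) (hf : LossAssumptions f L₁ L₂ η μ)
    (hx : ∀ j, x j ∈ cube d) : BddBelow (Set.range (erm f x)) := by
  refine ⟨erm f x 0 - ‖gradient (erm f x) 0‖ ^ 2 / (2 * μ), ?_⟩
  rintro _ ⟨u, rfl⟩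
  exact sub_norm_gradient_sq_le hμ (strongly_convex_erm hn hf hx) u 0

/-- Convergence of LPI-GD when every coordinate of the interpolated partial derivatives is
`δ`-accurate. -/
theorem lpigd_error_le (hμ : 0 < μ) (hσ : 1 < L₁ / μ) (hn : 1 ≤ n)
    (hf : LossAssumptions f L₁ L₂ η μ) (hx : ∀ j, x j ∈ cube d) {K : ℝ → ℝ} {b c δ : ℝ}
    (hδ : ∀ θ i j, |interpolator K (order η) (gridSize d η L₂ b c δ)
      (bandwidth d (order η) (gridSize d η L₂ b c δ)) (fun y => oracle f y θ i) (x j)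
        - gradient (f (x j)) θ i| ≤ δ) (θ₀ : EuclideanSpace ℝ (Fin p)) (t : ℕ) :
    erm f x (lpigd (oracle f) x K L₁ L₂ η b c (fun _ => δ) θ₀ t) - ermInf f x ≤
      (1 - 1 / (L₁ / μ)) ^ t * (erm f x θ₀ - ermInf f x) + p / (2 * μ) * δ ^ 2 := by
  have hL : 0 < L₁ := by
    rw [lt_div_iff₀ hμ] at hσ; linarith
  have hn' : (0 : ℝ) < n := by exact_mod_cast hn
  obtain ⟨h0, h1⟩ := contraction_mem hσ
  -- Averaging over the data keeps each coordinate error below `δ`; the `p` coordinates then add up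
  -- in squares.
  have hest : ∀ θ, ‖gradEstimate (oracle f) x K η L₂ b c δ θ - gradient (erm f x) θ‖ ^ 2
      ≤ p * δ ^ 2 := by
    intro θ
    rw [EuclideanSpace.norm_sq_eq]
    have : ∀ i ∈ Finset.univ, ‖(gradEstimate (oracle f) x K η L₂ b c δ θ
        - gradient (erm f x) θ) i‖ ^ 2 ≤ δ ^ 2 := by
      intro i _
      refine pow_le_pow_left₀ (norm_nonneg _) ?_ 2
      rw [gradient_erm hf hx, PiLp.sub_apply, PiLp.smul_apply, WithLp.ofLp_sum, Finset.sum_apply,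
        gradEstimate, smul_eq_mul, ← mul_sub, ← Finset.sum_sub_distrib, norm_mul,
        Real.norm_of_nonneg (by positivity), one_div, inv_mul_le_iff₀ hn']
      have h := norm_sum_le_of_le Finset.univ fun j (_ : j ∈ Finset.univ) =>
        (Real.norm_eq_abs _).trans_le (hδ θ i j)
      rw [Finset.sum_const, Finset.card_univ, Fintype.card_fin, nsmul_eq_mul] at h
      exact h
    refine (Finset.sum_le_sum this).trans ?_
    simp
  -- The Polyak–Łojasiewicz lower bound holds against every `u`, so it passes to the infimum and no
  -- minimizer is needed.
  have hrec : ∀ t, erm f x (lpigd (oracle f) x K L₁ L₂ η b c (fun _ => δ) θ₀ (t + 1))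
      - ermInf f x ≤ (1 - 1 / (L₁ / μ)) *
        (erm f x (lpigd (oracle f) x K L₁ L₂ η b c (fun _ => δ) θ₀ t) - ermInf f x)
        + p * δ ^ 2 / (2 * L₁) := fun t =>
    inexact_gradient_step hL hμ (differentiable_erm hf hx) (lipschitz_gradient_erm hn hf hx) _ _
      (le_ciInf fun u => sub_norm_gradient_sq_le hμ (strongly_convex_erm hn hf hx) u _) (hest _)
  refine (le_pow_mul_add_of_recursion
    (a := fun t => erm f x (lpigd (oracle f) x K L₁ L₂ η b c (fun _ => δ) θ₀ t) - ermInf f x)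
    (e := p * δ ^ 2 / (2 * L₁)) h0.le h1 (by positivity) hrec t).trans (le_of_eq ?_)
  simp only [lpigd]
  congr 1
  -- Here `1 - r = μ/L₁`, which turns the `2 L₁` of one step into the `2 μ` of the limit.
  rw [sub_sub_cancel]
  field_simp

end ERM

/-! ### Weighted least squares: Gram matrices and their weights -/

section WeightedLeastSquares

open Matrix

variable {ι S : Type*} [Fintype ι] [Fintype S] {ω : ι → ℝ} {V : ι → S → ℝ}

theorem dotProduct_gram_mulVec (v : S → ℝ) :
    v ⬝ᵥ ((∑ k, ω k • vecMulVec (V k) (V k)) *ᵥ v) = ∑ k, ω k * (v ⬝ᵥ V k) ^ 2 := by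
  rw [Matrix.sum_mulVec, dotProduct_sum]
  refine Finset.sum_congr rfl fun k _ => ?_
  rw [smul_mulVec, vecMulVec_mulVec, dotProduct_smul, dotProduct_smul, dotProduct_comm (V k) v]
  simp [sq]

/-- A kernel vector annihilates the quadratic form, a sum of nonnegative terms, so it is orthogonal
to every `V k` of positive weight. -/
theorem isUnit_gram [DecidableEq S] (hω : ∀ k, 0 ≤ ω k) (hV : ∀ v, (∀ k, 0 < ω k → v ⬝ᵥ V k = 0) → v = 0) :
    IsUnit (∑ k, ω k • vecMulVec (V k) (V k)).det := by
  rw [isUnit_iff_ne_zero]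
  intro h
  obtain ⟨v, hv0, hv⟩ := Matrix.exists_mulVec_eq_zero_iff.2 h
  refine hv0 (hV v fun k hk => ?_)
  have h1 := dotProduct_gram_mulVec (ω := ω) (V := V) v
  rw [hv, dotProduct_zero] at h1
  have h2 := (Finset.sum_eq_zero_iff_of_nonneg fun k _ =>
    mul_nonneg (hω k) (sq_nonneg (v ⬝ᵥ V k))).1 h1.symm k (Finset.mem_univ k)
  simpa [hk.ne'] using h2

/-- One entry of `C⁻¹ C = 1`; for `V k = U(·)` this is the reproduction of polynomials. -/
theorem sum_weight_mul [DecidableEq S] (hdet : IsUnit (∑ k, ω k • vecMulVec (V k) (V k)).det) (s₀ s : S) :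
    ∑ k, ω k * ((∑ k, ω k • vecMulVec (V k) (V k))⁻¹ *ᵥ V k) s₀ * V k s
      = if s₀ = s then 1 else 0 := by
  have h := congrFun₂ (nonsing_inv_mul _ hdet) s₀ s
  rw [one_apply] at h
  rw [← h]
  generalize (∑ k, ω k • vecMulVec (V k) (V k))⁻¹ = C
  rw [Matrix.mul_sum, Matrix.sum_apply]
  refine Finset.sum_congr rfl fun k _ => ?_
  rw [Matrix.mul_smul, Matrix.smul_apply, mul_vecMulVec, vecMulVec_apply, smul_eq_mul, mul_assoc]

/-- With `v` the row `s₀` of `C⁻¹`, the weights are `ω k (v ⬝ᵥ V k)`, and Cauchy–Schwarz bounds the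
squared sum by `(∑ ω k)(vᵀ C v) = (∑ ω k) v s₀`. Applying `hD` to this same `v` gives `(v s₀)² ≤ D v
s₀`. -/
theorem sum_abs_weight_sq_le [DecidableEq S] (hω : ∀ k, 0 ≤ ω k)
    (hdet : IsUnit (∑ k, ω k • vecMulVec (V k) (V k)).det) (s₀ : S) {A D : ℝ}
    (hA : ∑ k, ω k ≤ A) (hD : ∀ v : S → ℝ, v s₀ ^ 2 ≤ D * ∑ k, ω k * (v ⬝ᵥ V k) ^ 2) :
    (∑ k, |ω k * ((∑ k, ω k • vecMulVec (V k) (V k))⁻¹ *ᵥ V k) s₀|) ^ 2 ≤ A * D := by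
  set C := ∑ k, ω k • vecMulVec (V k) (V k)
  set v : S → ℝ := C⁻¹ s₀
  have hz : ∑ k, ω k * (v ⬝ᵥ V k) ^ 2 = v s₀ := by
    rw [← dotProduct_gram_mulVec, dotProduct_mulVec]
    have : v ᵥ* C = Pi.single s₀ 1 := by
      ext s
      have h := congrFun₂ (nonsing_inv_mul C hdet) s₀ s
      rw [Matrix.mul_apply] at h
      rw [vecMul, dotProduct]
      rw [h, one_apply, Pi.single_apply]
      simp [eq_comm]
    rw [this, single_dotProduct, one_mul]
  have hz0 : 0 ≤ v s₀ := by
    rw [← hz]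
    exact Finset.sum_nonneg fun k _ => mul_nonneg (hω k) (sq_nonneg _)
  have hzD : v s₀ ≤ D := by
    have h := hD v
    rw [hz] at h
    -- When `v s₀ = 0` it remains to see `0 ≤ D`, which follows by testing `hD` on a unit vector.
    rcases hz0.eq_or_lt with h0 | h0
    · have h1 := hD (Pi.single s₀ 1)
      rw [Pi.single_eq_same, one_pow] at h1
      rw [← h0]
      by_contra hneg
      have : D * ∑ k, ω k * ((Pi.single s₀ 1 : S → ℝ) ⬝ᵥ V k) ^ 2 ≤ 0 :=
        mul_nonpos_of_nonpos_of_nonneg (not_le.1 hneg).le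
          (Finset.sum_nonneg fun k _ => mul_nonneg (hω k) (sq_nonneg _))
      linarith
    · rw [sq] at h
      exact le_of_mul_le_mul_right h h0
  have hcs : (∑ k, |ω k * (C⁻¹ *ᵥ V k) s₀|) ^ 2
      ≤ (∑ k, ω k) * ∑ k, ω k * (v ⬝ᵥ V k) ^ 2 := by
    refine Finset.sum_sq_le_sum_mul_sum_of_sq_le_mul _ (fun k _ => hω k)
      (fun k _ => mul_nonneg (hω k) (sq_nonneg _)) fun k _ => le_of_eq ?_
    rw [sq_abs]
    change (ω k * (v ⬝ᵥ V k)) ^ 2 = _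
    ring
  rw [hz] at hcs
  refine hcs.trans (mul_le_mul hA hzD hz0 ?_)
  exact (Finset.sum_nonneg fun k _ => hω k).trans hA

end WeightedLeastSquares

/-! ### Lagrange extrapolation in one variable -/

section Extrapolation

open Polynomial

/-- Extrapolation to `0` from `l + 1` separated nodes, with control of the coefficients. -/
theorem exists_extrapolation_coeff {l : ℕ} {τ : ℝ} (hτ : 0 < τ) (t : Fin (l + 1) → ℝ)
    (ht : ∀ i, |t i| ≤ (l + 1) * τ) (hsep : ∀ i j, i ≠ j → τ ≤ |t i - t j|) :
    ∃ a : Fin (l + 1) → ℝ, (∀ s ≤ l, ∑ i, a i * t i ^ s = 0 ^ s) ∧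
      ∑ i, a i ^ 2 ≤ ((l : ℝ) + 1) ^ (2 * l + 1) := by
  have hinj : Set.InjOn t (Finset.univ : Finset (Fin (l + 1))) := fun i _ j _ hij => by
    by_contra hne
    have := hsep i j hne
    rw [hij, sub_self, abs_zero] at this
    linarith
  refine ⟨fun i => (Lagrange.basis Finset.univ t i).eval 0, fun s hs => ?_, ?_⟩
  · have h := Lagrange.eq_interpolate (f := (X : ℝ[X]) ^ s) hinj (by
      rw [degree_X_pow, Finset.card_univ, Fintype.card_fin]
      exact_mod_cast Nat.lt_succ_of_le hs)
    have h2 := congrArg (eval 0) h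
    rw [Lagrange.interpolate_apply, eval_finsetSum] at h2
    simp only [eval_pow, eval_X, eval_mul, eval_C] at h2
    rw [h2]
    exact Finset.sum_congr rfl fun i _ => mul_comm _ _
  -- Each basis polynomial at 0 has `l` factors `|t j| / |t i - t j| ≤ (l+1)τ/τ`.
  · have hb : ∀ i, |(Lagrange.basis Finset.univ t i).eval 0| ≤ ((l : ℝ) + 1) ^ l := by
      intro i
      rw [Lagrange.basis, eval_prod, Finset.abs_prod]
      have : ∀ j ∈ Finset.univ.erase i, |eval 0 (Lagrange.basisDivisor (t i) (t j))|
          ≤ (l : ℝ) + 1 := by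
        intro j hj
        have hij := hsep i j (Finset.ne_of_mem_erase hj).symm
        simp only [Lagrange.basisDivisor, eval_mul, eval_C, eval_sub, eval_X, zero_sub, abs_mul,
          abs_inv, abs_neg]
        rw [inv_mul_le_iff₀ (hτ.trans_le hij)]
        calc |t j| ≤ (l + 1) * τ := ht j
          _ ≤ (l + 1) * |t i - t j| := by gcongr
          _ = _ := mul_comm _ _
      refine (Finset.prod_le_prod (fun _ _ => abs_nonneg _) this).trans ?_
      rw [Finset.prod_const, Finset.card_erase_of_mem (Finset.mem_univ i), Finset.card_univ,
        Fintype.card_fin, Nat.add_sub_cancel]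
    calc ∑ i, (Lagrange.basis Finset.univ t i).eval 0 ^ 2
        ≤ ∑ _i : Fin (l + 1), (((l : ℝ) + 1) ^ l) ^ 2 := by
          refine Finset.sum_le_sum fun i _ => ?_
          rw [← sq_abs]
          exact pow_le_pow_left₀ (abs_nonneg _) (hb i) 2
      _ = _ := by
          rw [Finset.sum_const, Finset.card_univ, Fintype.card_fin, nsmul_eq_mul]
          push_cast
          ring

end Extrapolation

/-! ### Polynomials on tensor product grids -/

section Tensor

open Matrix

variable {d l : ℕ}

theorem prod_zero_pow_multiIndex (s : MultiIndex d l) :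
    ∏ j, (0 : ℝ) ^ (s.1 j : ℕ) = if zeroIndex d l = s then 1 else 0 := by
  split_ifs with h
  · subst h
    simp [zeroIndex]
  · obtain ⟨j, hj⟩ : ∃ j, (s.1 j : ℕ) ≠ 0 := by
      by_contra! hs
      exact h (Subtype.ext (funext fun j => Fin.ext (by simp [zeroIndex, hs j])))
    exact Finset.prod_eq_zero (Finset.mem_univ j) (zero_pow hj)

/-- Tensor product extrapolation: a polynomial of degree at most `l` is controlled at `0` by its
values on a tensor product grid. -/
theorem coeff_zero_sq_le {τ : ℝ} (hτ : 0 < τ) (t : Fin d → Fin (l + 1) → ℝ)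
    (ht : ∀ j i, |t j i| ≤ (l + 1) * τ) (hsep : ∀ j i i', i ≠ i' → τ ≤ |t j i - t j i'|)
    (v : MultiIndex d l → ℝ) :
    v (zeroIndex d l) ^ 2 ≤ (((l : ℝ) + 1) ^ (2 * l + 1)) ^ d *
      ∑ i : Fin d → Fin (l + 1), (v ⬝ᵥ U l (fun j => t j (i j))) ^ 2 := by
  choose a ha ha2 using fun j => exists_extrapolation_coeff hτ (t j) (ht j) (hsep j)
  -- Products of one-variable coefficients extrapolate every monomial to the origin, where only the
  -- constant one survives. Cauchy–Schwarz follows, and the sum of squared products factors over the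
  -- coordinates.
  have key : v (zeroIndex d l) =
      ∑ i : Fin d → Fin (l + 1), (∏ j, a j (i j)) * (v ⬝ᵥ U l (fun j => t j (i j))) := by
    have hs : ∀ s : MultiIndex d l,
        ∑ i : Fin d → Fin (l + 1), (∏ j, a j (i j)) * U l (fun j => t j (i j)) s
          = if zeroIndex d l = s then 1 else 0 := by
      intro s
      have h1 : ∑ i : Fin d → Fin (l + 1), ∏ j, (a j (i j) * t j (i j) ^ (s.1 j : ℕ))
          = if zeroIndex d l = s then 1 else 0 := by
        rw [← prod_zero_pow_multiIndex, ← Fintype.piFinset_univ,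
          ← Finset.prod_univ_sum (fun _ => Finset.univ) fun j i => a j i * t j i ^ (s.1 j : ℕ)]
        exact Finset.prod_congr rfl fun j _ => ha j _ (Nat.lt_succ_iff.1 (s.1 j).2)
      simp only [U, ← mul_div_assoc, ← Finset.prod_mul_distrib]
      rw [← Finset.sum_div, h1]
      split_ifs with h
      · subst h
        simp [zeroIndex]
      · simp
    simp only [dotProduct, Finset.mul_sum]
    rw [Finset.sum_comm]
    calc v (zeroIndex d l) = ∑ s, v s * (if zeroIndex d l = s then 1 else 0) := by simp
      _ = _ := Finset.sum_congr rfl fun s _ => by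
          rw [← hs, Finset.mul_sum]
          exact Finset.sum_congr rfl fun i _ => by ring
  rw [key]
  refine (Finset.sum_mul_sq_le_sq_mul_sq _ _ _).trans ?_
  refine mul_le_mul_of_nonneg_right ?_ (Finset.sum_nonneg fun _ _ => sq_nonneg _)
  simp only [← Finset.prod_pow]
  rw [← Fintype.piFinset_univ, ← Finset.prod_univ_sum (fun _ => Finset.univ) fun j i => a j i ^ 2]
  refine (Finset.prod_le_prod (fun j _ => Finset.sum_nonneg fun _ _ => sq_nonneg _)
    fun j _ => ha2 j).trans ?_
  simp

/-- A polynomial of degree at most `l` which vanishes on a tensor product grid with `l + 1` nodes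
in each coordinate is zero. -/
theorem coeff_eq_zero_of_grid (t : Fin d → Fin (l + 1) → ℝ) (ht : ∀ j, Function.Injective (t j))
    (v : MultiIndex d l → ℝ) (hv : ∀ i : Fin d → Fin (l + 1), v ⬝ᵥ U l (fun j => t j (i j)) = 0) :
    v = 0 := by
  let e : MultiIndex d l → Fin d →₀ ℕ := fun s => Finsupp.equivFunOnFinite.symm fun j => s.1 j
  have he : Function.Injective e := fun s s' h => by
    refine Subtype.ext (funext fun j => Fin.ext ?_)
    exact DFunLike.congr_fun h j
  -- Since `U` carries the factor `1/s!`, this polynomial takes the value `v ⬝ᵥ U l u` at `u`.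
  let P : MvPolynomial (Fin d) ℝ :=
    ∑ s, MvPolynomial.monomial (e s) (v s / ∏ i, (Nat.factorial (s.1 i : ℕ) : ℝ))
  have hP : P = 0 := by
    refine MvPolynomial.eq_zero_of_eval_zero_at_prod_finset P
      (fun j => Finset.univ.image (t j)) (fun j => ?_) fun x hx => ?_
    · rw [Finset.card_image_of_injective _ (ht j), Finset.card_univ, Fintype.card_fin,
        Nat.lt_succ_iff]
      refine (MvPolynomial.degreeOf_sum_le _ _ _).trans (Finset.sup_le fun s _ => ?_)
      refine (MvPolynomial.degreeOf_le_iff.2 fun m hm => ?_)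
      have := Finset.mem_singleton.1 (MvPolynomial.support_monomial_subset hm)
      subst this
      exact Nat.lt_succ_iff.1 (s.1 j).2
    · simp only [Finset.mem_image, Finset.mem_univ, true_and] at hx
      choose i hi using hx
      have := hv i
      rw [show (fun j => t j (i j)) = x from funext hi] at this
      rw [← this, map_sum, dotProduct]
      refine Finset.sum_congr rfl fun s _ => ?_
      rw [MvPolynomial.eval_monomial, Finsupp.prod_fintype _ _ (by simp), U]
      simp only [e, Finsupp.equivFunOnFinite_symm_apply_apply]
      ring
  ext s
  have h := congrArg (MvPolynomial.coeff (e s)) hP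
  rw [MvPolynomial.coeff_sum, MvPolynomial.coeff_zero] at h
  simp only [MvPolynomial.coeff_monomial, he.eq_iff, Finset.sum_ite_eq', Finset.mem_univ,
    if_true] at h
  have hne : ∏ i, (Nat.factorial (s.1 i : ℕ) : ℝ) ≠ 0 :=
    Finset.prod_ne_zero_iff.2 fun i _ => by positivity
  simpa [hne] using h

end Tensor

/-! ### Grid points inside the kernel window -/

section Grid

/-- The `l + 1` grid points to the right of `x`. -/
theorem exists_grid_nodes {l m : ℕ} {h x : ℝ} (hm : 1 ≤ m) (hh : 0 < h) (hx : 0 < x)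
    (hxh : x + h ≤ 1) (hl : (l : ℝ) + 1 ≤ m * h) :
    ∃ κ : Fin (l + 1) → Fin m, Function.Injective κ ∧
      (∀ i, (((κ i : ℕ) + 1 : ℝ) / m - x) / h ∈ Set.Icc (-1 : ℝ) 1) ∧
      (∀ i, |(((κ i : ℕ) + 1 : ℝ) / m - x) / h| ≤ (l + 1) * (1 / (m * h))) ∧
      ∀ i j, i ≠ j → 1 / (m * h) ≤
        |(((κ i : ℕ) + 1 : ℝ) / m - x) / h - (((κ j : ℕ) + 1 : ℝ) / m - x) / h| := by
  have hm' : (0 : ℝ) < m := by exact_mod_cast hm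
  have hk := Nat.le_ceil (m * x)
  have hk' := Nat.ceil_lt_add_one (mul_pos hm' hx).le
  have hk0 : 1 ≤ ⌈m * x⌉₊ := Nat.one_le_ceil_iff.2 (mul_pos hm' hx)
  -- The nodes are `q/m, …, (q+l)/m`. The grid point of index `k` is `(k+1)/m`, hence the indices `q
  -- - 1 + i`; `x + h ≤ 1` and `l + 1 ≤ m h` keep them on the grid.
  set q := ⌈m * x⌉₊
  have hqm : q + l ≤ m := by
    have : ((q + l : ℕ) : ℝ) < m + 1 := by
      push_cast
      nlinarith
    have : q + l < m + 1 := by exact_mod_cast this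
    omega
  have hval : ∀ i : Fin (l + 1), (((q - 1 + i : ℕ) : ℝ) + 1 : ℝ) = q + (i : ℕ) := by
    intro i
    push_cast [Nat.cast_sub hk0]
    ring
  have hil : ∀ i : Fin (l + 1), ((i : ℕ) : ℝ) ≤ l := fun i => by
    exact_mod_cast Nat.lt_succ_iff.1 i.2
  have hrw : ∀ i : Fin (l + 1), ((q + (i : ℕ) : ℝ) / m - x) / h = (q - m * x + (i : ℕ)) / (m * h) :=
    fun i => by field_simp; ring
  have hb : ∀ i : Fin (l + 1), 0 ≤ (q - m * x + (i : ℕ)) / (m * h) ∧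
      (q - m * x + (i : ℕ)) / (m * h) ≤ (l + 1) * (1 / (m * h)) := by
    intro i
    have := hil i
    refine ⟨div_nonneg (by linarith [(Nat.cast_nonneg (i : ℕ) : (0 : ℝ) ≤ _)]) (by positivity), ?_⟩
    rw [mul_one_div]
    exact div_le_div_of_nonneg_right (by linarith) (by positivity)
  refine ⟨fun i => ⟨q - 1 + i, by omega⟩, fun i j hij => ?_, fun i => ?_, fun i => ?_,
    fun i j hij => ?_⟩
  · have := Fin.mk.inj_iff.1 hij
    exact Fin.ext (by omega)
  · simp only [hval, hrw]
    refine ⟨by linarith [(hb i).1], (hb i).2.trans ?_⟩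
    rw [mul_one_div, div_le_one (by positivity)]
    exact hl
  · simp only [hval, hrw]
    rw [abs_of_nonneg (hb i).1]
    exact (hb i).2
  · simp only [hval, hrw]
    rw [← sub_div, abs_div, abs_of_pos (mul_pos hm' hh)]
    refine div_le_div_of_nonneg_right ?_ (by positivity)
    rw [add_sub_add_left_eq_sub]
    have : (1 : ℤ) ≤ |((i : ℕ) : ℤ) - (j : ℕ)| := by
      have := Fin.val_ne_of_ne hij
      exact Int.one_le_abs (by omega)
    exact_mod_cast this

/-- A window of length `2h` contains at most `2mh + 1 ≤ 3mh` grid points. -/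
theorem sum_kernel_le {m : ℕ} {h x b c : ℝ} {K : ℝ → ℝ} (hK : IsKernel K b c) (hb : 0 < b)
    (hbc : b ≤ c) (hm : 1 ≤ m) (hh : 0 < h) (hmh : 1 ≤ m * h) :
    ∑ k : Fin m, K ((((k : ℕ) + 1 : ℝ) / m - x) / h) ≤ 3 * c * (m * h) := by
  classical
  have hm' : (0 : ℝ) < m := by exact_mod_cast hm
  have hc : 0 < c := hb.trans_le hbc
  set s : Finset (Fin m) :=
    Finset.univ.filter fun k => (((k : ℕ) + 1 : ℝ) / m - x) / h ∈ Set.Icc (-1 : ℝ) 1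
  have h1 : ∑ k : Fin m, K ((((k : ℕ) + 1 : ℝ) / m - x) / h) ≤ s.card * c := by
    rw [← nsmul_eq_mul, ← Finset.sum_const, Finset.sum_filter]
    refine Finset.sum_le_sum fun k _ => ?_
    split_ifs with hk
    · exact (hK.mem_Icc _ hk).2
    · exact (hK.eq_zero _ hk).le
  have h2 : (s.card : ℝ) ≤ 2 * (m * h) + 1 := by
    have hcard : s.card ≤ (Finset.Icc ⌈m * (x - h)⌉ ⌊m * (x + h)⌋).card := by
      refine Finset.card_le_card_of_injOn (fun k => ((k : ℕ) : ℤ) + 1) (fun k hk => ?_) ?_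
      · have hk := (Finset.mem_filter.1 hk).2
        rw [Set.mem_Icc, le_div_iff₀ hh, div_le_iff₀ hh, le_sub_iff_add_le, sub_le_iff_le_add,
          le_div_iff₀ hm', div_le_iff₀ hm'] at hk
        rw [Finset.coe_Icc, Set.mem_Icc, Int.ceil_le, Int.le_floor]
        push_cast
        constructor <;> nlinarith [hk.1, hk.2]
      · intro k _ k' _ hkk
        exact Fin.ext (by simpa using hkk)
    rw [Int.card_Icc] at hcard
    have h3 : ((⌊m * (x + h)⌋ + 1 - ⌈m * (x - h)⌉).toNat : ℝ) ≤ 2 * (m * h) + 1 := by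
      have h4 : (((⌊m * (x + h)⌋ + 1 - ⌈m * (x - h)⌉).toNat : ℤ) : ℝ)
          = ((max (⌊m * (x + h)⌋ + 1 - ⌈m * (x - h)⌉) 0 : ℤ) : ℝ) := by
        rw [Int.toNat_eq_max]
      rw [Int.cast_natCast] at h4
      rw [h4, Int.cast_max]
      refine max_le ?_ (by push_cast; positivity)
      push_cast
      have := Int.floor_le (m * (x + h))
      have := Int.le_ceil (m * (x - h))
      linarith
    exact (by exact_mod_cast hcard : (s.card : ℝ) ≤ _).trans h3
  calc _ ≤ s.card * c := h1
    _ ≤ (3 * (m * h)) * c := by gcongr; linarith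
    _ = _ := by ring

end Grid

/-! ### Properties of the interpolation weights -/

section Weights

variable {d l m : ℕ} {h b c : ℝ} {K : ℝ → ℝ} {x : Fin d → ℝ}

theorem IsKernel.nonneg (hK : IsKernel K b c) (hb : 0 < b) (u : ℝ) : 0 ≤ K u := by
  by_cases hu : u ∈ Set.Icc (-1 : ℝ) 1
  · exact hb.le.trans (hK.mem_Icc u hu).1
  · exact (hK.eq_zero u hu).ge

theorem B_eq (K : ℝ → ℝ) (l m : ℕ) (h : ℝ) (x : Fin d → ℝ) :
    B K l m h x = ∑ k : Fin d → Fin m,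
      (1 / ((m : ℝ) * h) ^ d * prodKernel K h x (gridPoint k)) •
      Matrix.vecMulVec (U l (fun i => (gridPoint k i - x i) / h))
        (U l (fun i => (gridPoint k i - x i) / h)) := by
  rw [B, Finset.smul_sum]
  simp only [smul_smul]

theorem weight_eq (K : ℝ → ℝ) (l m : ℕ) (h : ℝ) (x : Fin d → ℝ) (k : Fin d → Fin m) :
    weight K l m h x k = 1 / ((m : ℝ) * h) ^ d * prodKernel K h x (gridPoint k) *
      (B K l m h x)⁻¹.mulVec (U l (fun i => (gridPoint k i - x i) / h)) (zeroIndex d l) := rfl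

/-- The interpolation weights reproduce polynomials, are localized, and have a bounded `ℓ¹`-norm. -/
theorem weight_spec (hK : IsKernel K b c) (hb : 0 < b) (hbc : b ≤ c) (hm : 1 ≤ m) (hh : 0 < h)
    (hl : (l : ℝ) + 1 ≤ m * h) (hx : ∀ j, 0 < x j) (hxh : ∀ j, x j + h ≤ 1) :
    (∀ s, ∑ k : Fin d → Fin m,
        weight K l m h x k * U l (fun i => (gridPoint k i - x i) / h) s
          = if zeroIndex d l = s then 1 else 0) ∧
      (∀ k : Fin d → Fin m, weight K l m h x k ≠ 0 → ∀ j, |gridPoint k j - x j| ≤ h) ∧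
      (∑ k : Fin d → Fin m, |weight K l m h x k|) ^ 2 ≤
        (3 * c) ^ d * ((m * h / b * ((l : ℝ) + 1) ^ (2 * l + 1)) ^ d) := by
  have hm' : (0 : ℝ) < m := by exact_mod_cast hm
  have hmh : 0 < m * h := mul_pos hm' hh
  have hc : 0 < c := hb.trans_le hbc
  choose κ hκ hκI hκt hκs using fun j => exists_grid_nodes hm hh (hx j) (hxh j) hl
  have hω : ∀ k : Fin d → Fin m,
      0 ≤ 1 / ((m : ℝ) * h) ^ d * prodKernel K h x (gridPoint k) := fun k =>
    mul_nonneg (by positivity) (Finset.prod_nonneg fun j _ => hK.nonneg hb _)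
  have hω' : ∀ i : Fin d → Fin (l + 1), b ^ d / (m * h) ^ d ≤
      1 / ((m : ℝ) * h) ^ d * prodKernel K h x (gridPoint fun j => κ j (i j)) := by
    intro i
    rw [div_eq_inv_mul, one_div]
    refine mul_le_mul_of_nonneg_left ?_ (by positivity)
    have := Finset.prod_le_prod (s := Finset.univ) (f := fun _ : Fin d => b)
      (g := fun j => K ((gridPoint (fun j => κ j (i j)) j - x j) / h)) (fun _ _ => hb.le)
      fun j _ => (hK.mem_Icc _ (hκI j (i j))).1
    rw [Finset.prod_const, Finset.card_univ, Fintype.card_fin] at this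
    exact this
  have hdet : IsUnit (B K l m h x).det := by
    rw [B_eq]
    refine isUnit_gram hω fun v hv => coeff_eq_zero_of_grid
      (fun j i => (((κ j i : ℕ) + 1 : ℝ) / m - x j) / h) (fun j i i' hii => ?_) v fun i =>
        hv (fun j => κ j (i j)) (lt_of_lt_of_le (by positivity) (hω' i))
    by_contra hne
    have := hκs j i i' hne
    simp only at hii
    rw [hii, sub_self, abs_zero] at this
    exact absurd this (not_le.2 (by positivity))
  rw [B_eq] at hdet
  refine ⟨fun s => ?_, fun k hk j => ?_, ?_⟩
  · have := sum_weight_mul hdet (zeroIndex d l) s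
    rw [← B_eq] at this
    exact this
  · by_contra hj
    refine hk ?_
    rw [weight_eq, prodKernel, Finset.prod_eq_zero (Finset.mem_univ j), mul_zero, zero_mul]
    refine hK.eq_zero _ fun hmem => hj ?_
    rw [Set.mem_Icc, ← abs_le, abs_div, abs_of_pos hh, div_le_one hh] at hmem
    exact hmem
  -- `A` bounds the total kernel mass. `D` is the extrapolation constant divided by `(b/(mh))^d`, a
  -- lower bound for the mass at each node of the tensor subgrid; other grid points only increase
  -- the quadratic form.
  · have := sum_abs_weight_sq_le hω hdet (zeroIndex d l) (A := (3 * c) ^ d)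
      (D := (m * h / b * ((l : ℝ) + 1) ^ (2 * l + 1)) ^ d) ?_ fun v => ?_
    · rw [← B_eq] at this
      exact this
    · simp only [prodKernel, gridPoint]
      rw [← Finset.mul_sum, ← Fintype.piFinset_univ,
        ← Finset.prod_univ_sum (fun _ => Finset.univ)
          fun j (k : Fin m) => K ((((k : ℕ) + 1 : ℝ) / m - x j) / h)]
      have := Finset.prod_le_prod (s := Finset.univ) (f := fun j : Fin d =>
        ∑ k : Fin m, K ((((k : ℕ) + 1 : ℝ) / m - x j) / h)) (g := fun _ => 3 * c * (m * h))
        (fun j _ => Finset.sum_nonneg fun k _ => hK.nonneg hb _)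
        fun j _ => sum_kernel_le hK hb hbc hm hh (by linarith [(Nat.cast_nonneg l : (0 : ℝ) ≤ l)])
      rw [Finset.prod_const, Finset.card_univ, Fintype.card_fin, mul_pow] at this
      rw [one_div, inv_mul_le_iff₀ (by positivity)]
      linarith
    · have h1 := coeff_zero_sq_le (by positivity : 0 < 1 / (m * h))
        (fun j i => (((κ j i : ℕ) + 1 : ℝ) / m - x j) / h) hκt hκs v
      refine h1.trans ?_
      rw [mul_pow, mul_comm ((m * h / b) ^ d), mul_assoc]
      refine mul_le_mul_of_nonneg_left ?_ (by positivity)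
      rw [Finset.mul_sum]
      have hinj : Function.Injective fun (i : Fin d → Fin (l + 1)) (j : Fin d) => κ j (i j) :=
        fun i i' hii => funext fun j => hκ j (congrFun hii j)
      refine le_trans ?_ (Finset.sum_le_sum_of_subset_of_nonneg
        (Finset.subset_univ (Finset.univ.image
          fun (i : Fin d → Fin (l + 1)) (j : Fin d) => κ j (i j)))
        fun k _ _ => mul_nonneg (by positivity) (mul_nonneg (hω k) (sq_nonneg _)))
      rw [Finset.sum_image hinj.injOn]
      refine Finset.sum_le_sum fun i _ => ?_
      rw [← mul_assoc]
      refine le_mul_of_one_le_left (sq_nonneg _) ?_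
      have h2 := mul_le_mul_of_nonneg_left (hω' i) (by positivity : 0 ≤ (m * h / b) ^ d)
      refine le_trans (le_of_eq ?_) h2
      rw [← div_pow, ← mul_pow]
      field_simp
      simp

end Weights

/-! ### Taylor expansion in the Hölder class -/

section Taylor

open scoped Nat

variable {d : ℕ} {g : (Fin d → ℝ) → ℝ} {x v : Fin d → ℝ}

theorem add_smul_mem_cube (hx : x ∈ cube d) (hxv : x + v ∈ cube d) {t : ℝ}
    (ht : t ∈ Set.Icc (0 : ℝ) 1) : x + t • v ∈ cube d :=
  (convex_Icc (0 : Fin d → ℝ) 1).add_smul_mem hx hxv ht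

theorem hasDerivWithinAt_iteratedFDerivWithin_line {k : ℕ} (hx : x ∈ cube d) (hxv : x + v ∈ cube d)
    (hg : DifferentiableOn ℝ (iteratedFDerivWithin ℝ k g (cube d)) (cube d)) {t : ℝ}
    (ht : t ∈ Set.Icc (0 : ℝ) 1) :
    HasDerivWithinAt
      (fun t : ℝ => iteratedFDerivWithin ℝ k g (cube d) (x + t • v) fun _ => v)
      (iteratedFDerivWithin ℝ (k + 1) g (cube d) (x + t • v) fun _ => v) (Set.Icc 0 1) t := by
  have h1 : HasDerivWithinAt (fun t : ℝ => x + t • v) v (Set.Icc 0 1) t := by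
    simpa using (((hasDerivAt_id t).smul_const v).const_add x).hasDerivWithinAt
  have h2 := (hg _ (add_smul_mem_cube hx hxv ht)).hasFDerivWithinAt.comp_hasDerivWithinAt t h1
    fun s hs => add_smul_mem_cube hx hxv hs
  have h3 := (ContinuousMultilinearMap.apply ℝ (fun _ : Fin k => Fin d → ℝ) ℝ
    (fun _ => v)).hasFDerivAt.comp_hasDerivWithinAt t h2
  exact h3

theorem iteratedDerivWithin_line {l k : ℕ} (hk : k ≤ l) (hx : x ∈ cube d) (hxv : x + v ∈ cube d)
    (hg : ∀ k < l, DifferentiableOn ℝ (iteratedFDerivWithin ℝ k g (cube d)) (cube d)) {t : ℝ}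
    (ht : t ∈ Set.Icc (0 : ℝ) 1) :
    iteratedDerivWithin k (fun t : ℝ => g (x + t • v)) (Set.Icc 0 1) t
      = iteratedFDerivWithin ℝ k g (cube d) (x + t • v) fun _ => v := by
  induction k generalizing t with
  | zero => simp
  | succ k ih =>
    rw [iteratedDerivWithin_succ]
    have h := hasDerivWithinAt_iteratedFDerivWithin_line hx hxv (hg k hk) ht
    rw [← h.derivWithin (uniqueDiffOn_Icc_zero_one t ht)]
    exact derivWithin_congr (fun s hs => ih (by omega) hs) (ih (by omega) ht)

/-- One-variable Taylor along the segment. The Lagrange remainder asks only that the derivative of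
order `n` be differentiable there. -/
theorem exists_taylor_lagrange {n : ℕ} (hx : x ∈ cube d) (hxv : x + v ∈ cube d)
    (hg : ∀ k < n + 1, DifferentiableOn ℝ (iteratedFDerivWithin ℝ k g (cube d)) (cube d)) :
    ∃ ξ ∈ Set.Icc (0 : ℝ) 1, g (x + v) =
      ∑ k ∈ Finset.range (n + 1), (k ! : ℝ)⁻¹ * iteratedFDerivWithin ℝ k g (cube d) x (fun _ => v)
        + ((n + 1)! : ℝ)⁻¹ *
          iteratedFDerivWithin ℝ (n + 1) g (cube d) (x + ξ • v) fun _ => v := by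
  have hline := fun {k : ℕ} (hk : k ≤ n + 1) {t : ℝ} (ht : t ∈ Set.Icc (0 : ℝ) 1) =>
    iteratedDerivWithin_line hk hx hxv hg ht
  have hdiff : ∀ k < n + 1, DifferentiableOn ℝ
      (iteratedDerivWithin k (fun t : ℝ => g (x + t • v)) (Set.Icc 0 1)) (Set.Icc 0 1) :=
    fun k hk => DifferentiableOn.congr (fun t ht =>
      (hasDerivWithinAt_iteratedFDerivWithin_line hx hxv (hg k hk) ht).differentiableWithinAt)
      fun t ht => hline hk.le ht
  have huI : Set.uIcc (0 : ℝ) 1 = Set.Icc 0 1 := Set.uIcc_of_le zero_le_one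
  have huI' : Set.uIoo (0 : ℝ) 1 = Set.Ioo 0 1 := Set.uIoo_of_le zero_le_one
  have hcd : ContDiffOn ℝ n (fun t : ℝ => g (x + t • v)) (Set.Icc 0 1) :=
    contDiffOn_of_differentiableOn_deriv (n := (n : ℕ∞)) fun m hm =>
      hdiff m (Nat.lt_succ_of_le (by exact_mod_cast hm))
  obtain ⟨ξ, hξ, h⟩ := taylor_mean_remainder_lagrange (f := fun t : ℝ => g (x + t • v))
    (zero_ne_one (α := ℝ)) (n := n) (by rwa [huI])
    (by rw [huI, huI']; exact (hdiff n (Nat.lt_succ_self n)).mono Set.Ioo_subset_Icc_self)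
  rw [huI'] at hξ
  have hξ' := Set.Ioo_subset_Icc_self hξ
  refine ⟨ξ, hξ', ?_⟩
  rw [huI, hline le_rfl hξ', taylor_within_apply, sub_eq_iff_eq_add'] at h
  simp only [one_smul, sub_zero, one_pow, mul_one, smul_eq_mul] at h
  rw [h]
  congr 1
  · refine Finset.sum_congr rfl fun k hk => ?_
    rw [hline (Finset.mem_range.1 hk).le (Set.left_mem_Icc.2 zero_le_one)]
    simp
  · rw [div_eq_inv_mul]

/-- Passes from directional derivatives to the mixed partials, which are what the Hölder condition
controls. -/
theorem multilinear_diag_eq_sum {k : ℕ} (Φ : (Fin d → ℝ) [×k]→L[ℝ] ℝ) (v : Fin d → ℝ) :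
    Φ (fun _ => v) = ∑ i : Fin k → Fin d,
      (∏ j, v (i j)) * Φ fun j => Pi.single (i j) (1 : ℝ) := by
  classical
  have hv : v = ∑ i, v i • (Pi.single i (1 : ℝ) : Fin d → ℝ) := by
    ext j
    simp [Finset.sum_apply, Pi.single_apply]
  conv_lhs => rw [hv]
  rw [Φ.map_sum]
  refine Finset.sum_congr rfl fun i _ => ?_
  rw [Φ.map_smul_univ, smul_eq_mul]

/-- The Taylor polynomial of order `order η` approximates a Hölder function. -/
theorem HolderClass.abs_sub_taylor_le {η L : ℝ} (hg : HolderClass η L g) (hL : 0 ≤ L)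
    (hl : 1 ≤ order η) (hη : (order η : ℝ) < η) (hx : x ∈ cube d) (hxv : x + v ∈ cube d) :
    |g (x + v) - ∑ k ∈ Finset.range (order η + 1),
      (k ! : ℝ)⁻¹ * iteratedFDerivWithin ℝ k g (cube d) x (fun _ => v)| ≤
      L * (∑ j, |v j|) ^ η := by
  obtain ⟨ξ, hξ, h⟩ := exists_taylor_lagrange (n := order η - 1) hx hxv
    (by rw [Nat.sub_add_cancel hl]; exact hg.differentiable)
  rw [Nat.sub_add_cancel hl] at h
  set N := ∑ j, |v j| with hN
  have hN0 : 0 ≤ N := Finset.sum_nonneg fun _ _ => abs_nonneg _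
  have hmix : ∀ i : Fin (order η) → Fin d,
      |mixedPartial (order η) i g (x + ξ • v) - mixedPartial (order η) i g x|
        ≤ L * N ^ (η - (order η : ℝ)) := by
    intro i
    refine (hg.holder i _ (add_smul_mem_cube hx hxv hξ) x hx).trans ?_
    refine mul_le_mul_of_nonneg_left (Real.rpow_le_rpow
      (Finset.sum_nonneg fun _ _ => abs_nonneg _) ?_ (by linarith)) hL
    refine Finset.sum_le_sum fun j _ => ?_
    simp only [Pi.add_apply, Pi.smul_apply, smul_eq_mul, add_sub_cancel_left, abs_mul]
    exact mul_le_of_le_one_left (abs_nonneg _) (abs_le.2 ⟨by linarith [hξ.1], hξ.2⟩)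
  have hsum : ∑ i : Fin (order η) → Fin d, ∏ j, |v (i j)| = N ^ order η := by
    rw [hN, ← Fin.prod_const, Finset.prod_univ_sum, Fintype.piFinset_univ]
  have hfact : ((order η)! : ℝ)⁻¹ ≤ 1 := inv_le_one_of_one_le₀
    (by exact_mod_cast Nat.one_le_iff_ne_zero.2 (Nat.factorial_ne_zero _))
  -- Subtracting the term of order `l` at `x` from the remainder leaves a difference of `l`-th
  -- derivatives at two points, to which the Hölder bound applies. The factor `1/l!` is discarded.
  rw [h, Finset.sum_range_succ, add_sub_add_left_eq_sub, ← mul_sub, abs_mul,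
    abs_of_nonneg (by positivity), multilinear_diag_eq_sum, multilinear_diag_eq_sum,
    ← Finset.sum_sub_distrib]
  refine (mul_le_of_le_one_left (abs_nonneg _) hfact).trans ?_
  calc _ ≤ ∑ i : Fin (order η) → Fin d, (∏ j, |v (i j)|) * (L * N ^ (η - (order η : ℝ))) := by
        refine (Finset.abs_sum_le_sum_abs _ _).trans (Finset.sum_le_sum fun i _ => ?_)
        rw [← mul_sub, abs_mul, Finset.abs_prod]
        exact mul_le_mul_of_nonneg_left (hmix i) (Finset.prod_nonneg fun _ _ => abs_nonneg _)
    _ = L * N ^ η := by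
        rw [← Finset.sum_mul, hsum, mul_left_comm, ← Real.rpow_natCast,
          ← Real.rpow_add_of_nonneg hN0 (by positivity) (by linarith)]
        congr 2
        ring

end Taylor

/-! ### Interpolation error in terms of the weights -/

section Interpolation

open scoped Nat

variable {d l m : ℕ} {h b c : ℝ} {K : ℝ → ℝ} {x : Fin d → ℝ}

/-- Monomials of degree `k ≤ l`, indexed by sequences of coordinates, are multiples of entries of
`U`. -/
theorem exists_prod_eq_U {k : ℕ} (hk : k ≤ l) (i : Fin k → Fin d) :
    ∃ (s : MultiIndex d l) (a : ℝ), (k ≠ 0 → zeroIndex d l ≠ s) ∧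
      ∀ u : Fin d → ℝ, ∏ j, u (i j) = a * U l u s := by
  classical
  have hsum : ∑ r, (Finset.univ.filter fun j => i j = r).card = k := by
    rw [← Finset.card_eq_sum_card_fiberwise (f := i) (t := Finset.univ) (fun _ _ => by simp)]
    simp
  have hle : ∀ r, (Finset.univ.filter fun j => i j = r).card ≤ l := fun r =>
    (Finset.single_le_sum (f := fun r => (Finset.univ.filter fun j => i j = r).card)
      (fun _ _ => Nat.zero_le _) (Finset.mem_univ r)).trans (hsum.trans_le hk)
  -- `s` counts the occurrences of each coordinate in `i`, and `a = s!` undoes the normalization of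
  -- `U`.
  refine ⟨⟨fun r => ⟨(Finset.univ.filter fun j => i j = r).card, Nat.lt_succ_of_le (hle r)⟩,
    hsum.trans_le hk⟩, ∏ r, (Nat.factorial (Finset.univ.filter fun j => i j = r).card : ℝ),
    fun hk0 h0 => hk0 ?_, fun u => ?_⟩
  · rw [← hsum]
    refine Finset.sum_eq_zero fun r _ => ?_
    exact (congrArg Fin.val (congrFun (congrArg Subtype.val h0) r)).symm
  · rw [U, mul_div_cancel₀ _ (Finset.prod_ne_zero_iff.2 fun r _ => by positivity)]
    rw [← Finset.prod_fiberwise_of_maps_to (s := Finset.univ) (t := Finset.univ) (g := i)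
      (fun _ _ => Finset.mem_univ _)]
    refine Finset.prod_congr rfl fun r _ => ?_
    rw [Finset.prod_congr rfl fun j hj => by rw [(Finset.mem_filter.1 hj).2], Finset.prod_const]

/-- Reproduction of Taylor polynomials by the interpolation weights. -/
theorem sum_weight_mul_taylor (hh : 0 < h)
    (hw : ∀ s, ∑ k : Fin d → Fin m,
        weight K l m h x k * U l (fun i => (gridPoint k i - x i) / h) s
          = if zeroIndex d l = s then 1 else 0)
    (Φ : (k : ℕ) → (Fin d → ℝ) [×k]→L[ℝ] ℝ) :
    ∑ y : Fin d → Fin m, weight K l m h x y *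
      ∑ k ∈ Finset.range (l + 1), (k ! : ℝ)⁻¹ * Φ k (fun _ => gridPoint y - x)
        = Φ 0 ![] := by
  have hk : ∀ k ∈ Finset.range (l + 1), ∑ y : Fin d → Fin m, weight K l m h x y *
      ((k ! : ℝ)⁻¹ * Φ k (fun _ => gridPoint y - x)) = if k = 0 then Φ 0 ![] else 0 := by
    intro k hk
    have hkl : k ≤ l := Nat.lt_succ_iff.1 (Finset.mem_range.1 hk)
    split_ifs with hk0
    · subst hk0
      have h1 := hw (zeroIndex d l)
      simp only [U, zeroIndex] at h1
      simp only [Fin.val_zero, pow_zero, Finset.prod_const_one, Nat.factorial_zero, Nat.cast_one,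
        div_one, mul_one, if_true] at h1
      simp only [Nat.factorial_zero, Nat.cast_one, inv_one, one_mul]
      have h2 : ∀ y : Fin d → Fin m, Φ 0 (fun _ => gridPoint y - x) = Φ 0 ![] := fun y =>
        congrArg (Φ 0) (Subsingleton.elim _ _)
      simp only [h2]
      rw [← Finset.sum_mul, h1, one_mul]
    · simp only [multilinear_diag_eq_sum, Finset.mul_sum]
      rw [Finset.sum_comm]
      refine Finset.sum_eq_zero fun i _ => ?_
      obtain ⟨s, a, hs, ha⟩ := exists_prod_eq_U hkl i
      have h1 : ∀ y : Fin d → Fin m, ∏ j, (gridPoint y - x) (i j)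
          = h ^ k * (a * U l (fun i => (gridPoint y i - x i) / h) s) := by
        intro y
        rw [← ha, ← Fin.prod_const, ← Finset.prod_mul_distrib]
        refine Finset.prod_congr rfl fun j _ => ?_
        rw [mul_div_cancel₀ _ hh.ne', Pi.sub_apply]
      have h2 := hw s
      rw [if_neg (hs hk0)] at h2
      calc _ = ∑ y : Fin d → Fin m, (weight K l m h x y *
            U l (fun i => (gridPoint y i - x i) / h) s) *
            ((k ! : ℝ)⁻¹ * (h ^ k * a * Φ k fun j => Pi.single (i j) (1 : ℝ))) :=
          Finset.sum_congr rfl fun y _ => by rw [h1]; ring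
        _ = 0 := by rw [← Finset.sum_mul, h2, zero_mul]
  simp only [Finset.mul_sum]
  rw [Finset.sum_comm, Finset.sum_congr rfl hk]
  simp

theorem gridPoint_mem_cube (k : Fin d → Fin m) : gridPoint k ∈ cube d := by
  refine ⟨fun i => by simp only [gridPoint, Pi.zero_apply]; positivity, fun i => ?_⟩
  have h : ((k i : ℕ) : ℝ) + 1 ≤ m := by exact_mod_cast (k i).2
  exact div_le_one_of_le₀ h (Nat.cast_nonneg m)

/-- The interpolation error in terms of the `ℓ¹`-norm of the weights. -/
theorem abs_interpolator_sub_le {η L : ℝ} {g : (Fin d → ℝ) → ℝ} (hg : HolderClass η L g)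
    (hL : 0 ≤ L) (hl : 1 ≤ order η) (hη : (order η : ℝ) < η) (hx : x ∈ cube d) (hh : 0 < h)
    (hw : ∀ s, ∑ k : Fin d → Fin m,
        weight K (order η) m h x k * U (order η) (fun i => (gridPoint k i - x i) / h) s
          = if zeroIndex d (order η) = s then 1 else 0)
    (hloc : ∀ k : Fin d → Fin m, weight K (order η) m h x k ≠ 0 → ∀ j, |gridPoint k j - x j| ≤ h) :
    |interpolator K (order η) m h g x - g x| ≤
      L * (d * h) ^ η * ∑ k : Fin d → Fin m, |weight K (order η) m h x k| := by
  have h1 := sum_weight_mul_taylor hh hw fun k => iteratedFDerivWithin ℝ k g (cube d) x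
  rw [iteratedFDerivWithin_zero_apply] at h1
  rw [interpolator, ← h1, ← Finset.sum_sub_distrib, Finset.mul_sum]
  refine (Finset.abs_sum_le_sum_abs _ _).trans (Finset.sum_le_sum fun k _ => ?_)
  rw [mul_comm (g _), ← mul_sub, abs_mul, mul_comm]
  -- Only grid points within `h` of `x` in every coordinate matter, so the `ℓ¹`-distance in the
  -- Taylor bound is at most `d h`.
  by_cases hk : weight K (order η) m h x k = 0
  · simp [hk]
  refine mul_le_mul_of_nonneg_right ?_ (abs_nonneg _)
  have h2 := hg.abs_sub_taylor_le (v := gridPoint k - x) hL hl hη hx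
    (by rw [add_sub_cancel]; exact gridPoint_mem_cube k)
  rw [add_sub_cancel] at h2
  refine h2.trans (mul_le_mul_of_nonneg_left (Real.rpow_le_rpow
    (Finset.sum_nonneg fun _ _ => abs_nonneg _) ?_ ?_) hL)
  · refine (Finset.sum_le_sum fun j _ => hloc k hk j).trans ?_
    simp
  · exact (Nat.cast_nonneg _).trans hη.le

end Interpolation

/-! ### Smallness of `Λ` -/

section Constants

variable {d l : ℕ}

theorem two_pow_le_ratio_pow (hd : 1 ≤ d) (hl : d ≤ l) :
    (2 : ℝ) ^ d ≤ (((l : ℝ) + d) / d) ^ d := by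
  have hd' : (1 : ℝ) ≤ d := by exact_mod_cast hd
  have hl' : (d : ℝ) ≤ l := by exact_mod_cast hl
  refine pow_le_pow_left₀ zero_le_two ?_ d
  rw [le_div_iff₀ (by linarith)]
  linarith

theorem Lam_pos (hd : 1 ≤ d) (hl : d ≤ l) : 0 < Lam d l := by
  have hd' : (0 : ℝ) < d := by exact_mod_cast hd
  have hN := two_pow_le_ratio_pow hd hl
  have h2 : (1 : ℝ) < 2 ^ d := one_lt_pow₀ one_lt_two (by omega)
  have hN1 : 0 < (((l : ℝ) + d) / d) ^ d - 1 := by linarith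
  have hπ := Real.pi_pos
  rw [Lam]
  positivity

/-- `Λ(d,l)` is smaller than every negative power of `l + d` used below. -/
theorem Lam_mul_pow_le_one (hd : 2 ≤ d) (hl : d ≤ l) :
    Lam d l * ((l : ℝ) + d) ^ (5 * l * (d + 1)) ≤ 1 := by
  have hd' : (2 : ℝ) ≤ d := by exact_mod_cast hd
  have hl' : (d : ℝ) ≤ l := by exact_mod_cast hl
  have hN2 := two_pow_le_ratio_pow (by omega : 1 ≤ d) hl
  have h2d : (d : ℝ) + 1 ≤ 2 ^ d := by exact_mod_cast Nat.succ_le_of_lt (Nat.lt_two_pow_self (n := d))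
  have h4d : (4 : ℝ) ≤ 2 ^ d := by
    calc (4 : ℝ) = 2 ^ 2 := by norm_num
      _ ≤ 2 ^ d := pow_le_pow_right₀ one_le_two hd
  have he : (2 : ℝ) ^ d ≤ Real.exp 1 ^ d :=
    pow_le_pow_left₀ zero_le_two (by linarith [Real.exp_one_gt_d9]) d
  have hM : (1 : ℝ) ≤ (l : ℝ) + d := by linarith
  have hexp : 3 * (l : ℝ) * (Real.exp 1 * ((l : ℝ) + d) / d) ^ d
      = 3 * l * (Real.exp 1 ^ d * (((l : ℝ) + d) / d) ^ d) := by
    rw [mul_div_assoc, mul_pow]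
  have hMN : (d : ℝ) ^ d * (((l : ℝ) + d) / d) ^ d = ((l : ℝ) + d) ^ d := by
    rw [← mul_pow, mul_div_cancel₀ _ (by linarith)]
  rw [Lam, hexp]
  set N : ℝ := (((l : ℝ) + d) / d) ^ d
  set M : ℝ := (l : ℝ) + d
  have hN1 : 1 ≤ N := by linarith
  have h1 : (Real.pi * d / (8 * Real.exp 1 ^ 2)) ^ ((d : ℝ) * N) ≤ (d : ℝ) ^ ((d : ℝ) * N) := by
    refine Real.rpow_le_rpow (by positivity) ?_ (by positivity)
    have h := Real.add_one_le_exp 1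
    rw [div_le_iff₀ (by positivity), mul_comm]
    refine mul_le_mul_of_nonneg_left ?_ (by linarith)
    nlinarith [Real.pi_le_four]
  have h2 : (N - 1) ^ (N - 1) ≤ N ^ N :=
    (Real.rpow_le_rpow (by linarith) (by linarith) (by linarith)).trans
      (Real.rpow_le_rpow_of_exponent_le hN1 (by linarith))
  -- Since `d^d N = M^d`, all factors of `Λ` become powers of `M = l + d`, and only exponents remain
  -- to be compared.
  have h3 : (d : ℝ) ^ ((d : ℝ) * N) * N ^ N = M ^ ((d : ℝ) * N) := by
    rw [Real.rpow_mul (by linarith), Real.rpow_mul (by linarith), Real.rpow_natCast,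
      Real.rpow_natCast, ← Real.mul_rpow (by positivity) (by positivity), hMN]
  have h4 : (d : ℝ) * N + 5 * l * (d + 1) ≤ 3 * l * (Real.exp 1 ^ d * N) := by
    have h5 : 5 * ((d : ℝ) + 1) ≤ 2 * (Real.exp 1 ^ d * N) := by
      have : (2 : ℝ) ^ d * 2 ^ d ≤ Real.exp 1 ^ d * N := mul_le_mul he hN2 (by positivity)
        (by positivity)
      nlinarith
    have h6 : (d : ℝ) * N ≤ l * (Real.exp 1 ^ d * N) := by
      refine mul_le_mul hl' (le_mul_of_one_le_left (by linarith) (by linarith)) (by linarith)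
        (by linarith)
    nlinarith
  calc _ ≤ (d : ℝ) ^ ((d : ℝ) * N) * N ^ N * (1 / M ^ (3 * (l : ℝ) * (Real.exp 1 ^ d * N)))
        * M ^ (5 * l * (d + 1)) := by
        refine mul_le_mul_of_nonneg_right (mul_le_mul_of_nonneg_right
          (mul_le_mul h1 h2 (Real.rpow_nonneg (by linarith) _) (by positivity)) (by positivity))
          (by positivity)
    _ = M ^ ((d : ℝ) * N + 5 * l * (d + 1)) / M ^ (3 * (l : ℝ) * (Real.exp 1 ^ d * N)) := by
        rw [h3, Real.rpow_add (by linarith), ← Real.rpow_natCast M]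
        push_cast
        ring
    _ ≤ 1 := by
        rw [div_le_one (by positivity)]
        exact Real.rpow_le_rpow_of_exponent_le hM h4

theorem Lam_le_one (hd : 2 ≤ d) (hl : d ≤ l) : Lam d l ≤ 1 := by
  have hM : (1 : ℝ) ≤ (l : ℝ) + d := by
    have : (2 : ℝ) ≤ d := by exact_mod_cast hd
    linarith [(Nat.cast_nonneg l : (0 : ℝ) ≤ l)]
  exact (le_mul_of_one_le_right (Lam_pos (by omega) hl).le (one_le_pow₀ hM)).trans
    (Lam_mul_pow_le_one hd hl)

/-- The powers of `l` and `d` in the interpolation error are absorbed by `Λ(d,l)`. -/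
theorem Lam_mul_growth_le_one (hd : 19 ≤ d) (hl : d ≤ l) :
    Lam d l ^ d * ((l : ℝ) ^ (2 * l) * (12 * l * (3 * Real.exp 1) ^ d) ^ d
      * ((l : ℝ) + 1) ^ ((2 * l + 1) * d)) ≤ 1 := by
  have hd' : (19 : ℝ) ≤ d := by exact_mod_cast hd
  have hl' : (d : ℝ) ≤ l := by exact_mod_cast hl
  have hΛ := Lam_pos (by omega : 1 ≤ d) hl
  refine le_trans ?_ (Lam_mul_pow_le_one (by omega) hl)
  -- A single factor `Λ` of `Λ^d` suffices. As `d ≥ 19`, `M = l + d` dominates the constants `12`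
  -- and `3e`.
  refine mul_le_mul (pow_le_of_le_one hΛ.le (Lam_le_one (by omega) hl) (by omega)) ?_
    (by positivity) hΛ.le
  set M : ℝ := (l : ℝ) + d
  have h1 : (l : ℝ) ^ (2 * l) ≤ M ^ (2 * l) :=
    pow_le_pow_left₀ (by positivity) (by linarith) _
  have h2 : (12 * l * (3 * Real.exp 1) ^ d) ^ d ≤ (M * M * M ^ d) ^ d := by
    have he : 3 * Real.exp 1 ≤ M := by linarith [Real.exp_one_lt_d9]
    have h12 : 12 ≤ M := by linarith
    have hlM : (l : ℝ) ≤ M := by linarith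
    gcongr
  have h3 : ((l : ℝ) + 1) ^ ((2 * l + 1) * d) ≤ M ^ ((2 * l + 1) * d) :=
    pow_le_pow_left₀ (by positivity) (by linarith) _
  calc _ ≤ M ^ (2 * l) * (M * M * M ^ d) ^ d * M ^ ((2 * l + 1) * d) := by gcongr
    _ = M ^ (2 * l + (d + 2) * d + (2 * l + 1) * d) := by
        rw [pow_add, pow_add, pow_mul M (d + 2) d, pow_add M d 2]
        ring
    _ ≤ M ^ (5 * l * (d + 1)) := by
        refine pow_le_pow_right₀ (by linarith) ?_
        nlinarith

end Constants

/-! ### Accuracy `δ` of the local polynomial interpolator -/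

section InterpolationError

variable {d : ℕ} {η L₂ b c δ : ℝ}

theorem order_lt (hη : 0 < η) (hl : 1 ≤ order η) : (order η : ℝ) < η := by
  have h := Nat.ceil_lt_add_one hη.le
  rw [order] at hl ⊢
  rw [Nat.cast_sub (by omega)]
  push_cast
  linarith

theorem margin_pos (hd : 1 ≤ d) (hl : d ≤ order η) (hL : 0 < L₂) (hb : 0 < b) (hc : 0 < c) :
    0 < margin d η L₂ b c := by
  have hΛ := Lam_pos hd hl
  have hd' : (0 : ℝ) < d := by exact_mod_cast hd
  have hl' : (0 : ℝ) < order η := by exact_mod_cast hd.trans hl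
  rw [margin]
  positivity

theorem one_le_gridSize (hd : 1 ≤ d) (hl : d ≤ order η) (hL : 0 < L₂) (hb : 0 < b) (hc : 0 < c)
    (hδ : 0 < δ) : 1 ≤ gridSize d η L₂ b c δ := by
  have hΛ := Lam_pos hd hl
  have hd' : (0 : ℝ) < d := by exact_mod_cast hd
  refine Nat.one_le_ceil_iff.2 ?_
  positivity

/-- Equality would hold without the ceiling in `m`; rounding `m` up only shrinks `h`. The margin is
thus the unrounded bandwidth for `δ = 1`. -/
theorem bandwidth_le (hd : 1 ≤ d) (hl : d ≤ order η) (hL : 0 < L₂) (hb : 0 < b) (hc : 0 < c)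
    (hδ : 0 < δ) : bandwidth d (order η) (gridSize d η L₂ b c δ)
      ≤ margin d η L₂ b c * δ ^ (1 / η) := by
  have hΛ := Lam_pos hd hl
  have hd' : (0 : ℝ) < d := by exact_mod_cast hd
  have hm : (0 : ℝ) < gridSize d η L₂ b c δ := by exact_mod_cast one_le_gridSize hd hl hL hb hc hδ
  have hmg := margin_pos hd hl hL hb hc
  have hle : _ ≤ (gridSize d η L₂ b c δ : ℝ) := Nat.le_ceil _
  rw [bandwidth, div_le_iff₀ (by positivity)]
  have h1 : (1 / δ) ^ (1 / η) * δ ^ (1 / η) = 1 := by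
    rw [← Real.mul_rpow (by positivity) hδ.le, one_div_mul_cancel hδ.ne', Real.one_rpow]
  have h2 := mul_le_mul_of_nonneg_left hle
    (by positivity : 0 ≤ margin d η L₂ b c * δ ^ (1 / η) * Lam d (order η))
  refine le_trans (le_of_eq ?_) (h2.trans (le_of_eq (by ring)))
  rw [margin]
  calc 4 * (order η : ℝ) * (3 * Real.exp 1) ^ d
      = 4 * (order η : ℝ) * (3 * Real.exp 1) ^ d * ((1 / δ) ^ (1 / η) * δ ^ (1 / η)) := by
        rw [h1, mul_one]
    _ = _ := by
        generalize (1 / δ) ^ (1 / η) = u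
        generalize δ ^ (1 / η) = w
        field_simp
        ring

/-- The product `m h` does not depend on `m`, so the bound on the weights is uniform in `δ`. -/
theorem gridSize_mul_bandwidth {l m : ℕ} (hm : 1 ≤ m) :
    m * bandwidth d l m = 4 * l * (3 * Real.exp 1) ^ d / Lam d l := by
  have hm' : (m : ℝ) ≠ 0 := by exact_mod_cast (by omega : m ≠ 0)
  rw [bandwidth]
  field_simp

/-- The local polynomial interpolator approximates functions of the Hölder class up to `δ`. -/
theorem interpolation_error_le (hd : 19 ≤ d) (hη : 0 < η) (hl : d ≤ order η) (hL : 0 < L₂)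
    (hb : 0 < b) (hbc : b ≤ c) {K : ℝ → ℝ} (hK : IsKernel K b c) (hδ : 0 < δ) (hδ1 : δ ≤ 1)
    {x : Fin d → ℝ} (hx : ∀ i, x i ∈ Set.Icc (margin d η L₂ b c) (1 - margin d η L₂ b c))
    {g : (Fin d → ℝ) → ℝ} (hg : HolderClass η L₂ g) :
    |interpolator K (order η) (gridSize d η L₂ b c δ)
      (bandwidth d (order η) (gridSize d η L₂ b c δ)) g x - g x| ≤ δ := by
  have hc : 0 < c := hb.trans_le hbc
  have hd1 : 1 ≤ d := by omega
  have hd' : (19 : ℝ) ≤ d := by exact_mod_cast hd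
  have hl' : (d : ℝ) ≤ order η := by exact_mod_cast hl
  have hl0 : 0 < order η := hd1.trans hl
  have hlη := order_lt hη hl0
  have hΛ := Lam_pos hd1 hl
  have hΛ1 := Lam_le_one (by omega) hl
  have hm := one_le_gridSize hd1 hl hL hb hc hδ
  have hmg := margin_pos hd1 hl hL hb hc
  have hhle := bandwidth_le hd1 hl hL hb hc hδ
  have hmh := gridSize_mul_bandwidth (d := d) (l := order η) hm
  have hgrow := Lam_mul_growth_le_one hd hl
  have hΛl : Lam d (order η) * (order η : ℝ) ≤ 1 := by
    refine le_trans (mul_le_mul_of_nonneg_left ?_ hΛ.le) (Lam_mul_pow_le_one (by omega) hl)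
    have h1 : (1 : ℝ) ≤ (order η : ℝ) + d := by linarith
    refine le_trans (by linarith) (le_self_pow₀ h1 ?_)
    positivity
  set m := gridSize d η L₂ b c δ
  set h := bandwidth d (order η) m
  have hm' : (0 : ℝ) < m := by exact_mod_cast hm
  have hh : 0 < h := by
    have : 0 < m * h := by rw [hmh]; positivity
    exact pos_of_mul_pos_right this hm'.le
  have hhmg : h ≤ margin d η L₂ b c := hhle.trans
    (mul_le_of_le_one_right hmg.le (Real.rpow_le_one hδ.le hδ1 (by positivity)))
  have hlmh : (order η : ℝ) + 1 ≤ m * h := by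
    rw [hmh, le_div_iff₀ hΛ]
    have h1 : 1 ≤ (3 * Real.exp 1) ^ d := one_le_pow₀ (by linarith [Real.exp_one_gt_d9])
    nlinarith
  have hxc : x ∈ cube d :=
    ⟨fun i => hmg.le.trans (hx i).1, fun i => (hx i).2.trans (by simpa using hmg.le)⟩
  obtain ⟨hrep, hloc, hW⟩ := weight_spec hK hb hbc hm hh hlmh
    (fun j => hmg.trans_le (hx j).1) fun j => by linarith [(hx j).2]
  refine (abs_interpolator_sub_le hg hL.le (hd1.trans hl) hlη hxc hh hrep hloc).trans ?_
  set W := ∑ k : Fin d → Fin m, |weight K (order η) m h x k|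
  have hW0 : 0 ≤ W := Finset.sum_nonneg fun _ _ => abs_nonneg _
  set l := order η
  set Λ := Lam d l
  -- The factor `δ^(1/η)` in `h` becomes `δ`. The remaining base is at most 1, so its exponent may
  -- drop from `η` to `l`, and further to `d` for `b/c` and `Λ`.
  have hX : (d * h) ^ η ≤ δ * (1 / (2 * L₂ + 1) * (b / c) ^ d * Λ ^ d * (l : ℝ) ^ l) := by
    have hβ0 : 0 < b / c := by positivity
    have hβ : b / c ≤ 1 := (div_le_one hc).2 hbc
    have hρ0 : 0 < 1 / (2 * L₂ + 1) := by positivity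
    have hρ : 1 / (2 * L₂ + 1) ≤ 1 := (div_le_one (by positivity)).2 (by linarith)
    have h1 : d * margin d η L₂ b c = 2 / 55 * (1 / (2 * L₂ + 1)) * (b / c) * Λ * l := by
      rw [margin]
      field_simp
      rfl
    have h2 : d * h ≤ (1 / (2 * L₂ + 1) * (b / c) * (Λ * l)) * δ ^ (1 / η) := by
      calc d * h ≤ d * (margin d η L₂ b c * δ ^ (1 / η)) := by gcongr
        _ = (2 / 55) * ((1 / (2 * L₂ + 1) * (b / c) * (Λ * l)) * δ ^ (1 / η)) := by
            rw [← mul_assoc, h1]; ring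
        _ ≤ _ := mul_le_of_le_one_left (by positivity) (by norm_num)
    have h3 : 1 / (2 * L₂ + 1) * (b / c) * (Λ * l) ≤ 1 :=
      mul_le_one₀ (mul_le_one₀ hρ hβ0.le hβ) (by positivity) hΛl
    calc (d * h) ^ η ≤ ((1 / (2 * L₂ + 1) * (b / c) * (Λ * l)) * δ ^ (1 / η)) ^ η :=
          Real.rpow_le_rpow (by positivity) h2 hη.le
      _ = (1 / (2 * L₂ + 1) * (b / c) * (Λ * l)) ^ η * δ := by
          rw [Real.mul_rpow (by positivity) (by positivity), ← Real.rpow_mul hδ.le,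
            one_div_mul_cancel hη.ne', Real.rpow_one]
      _ ≤ (1 / (2 * L₂ + 1) * (b / c) * (Λ * l)) ^ l * δ := by
          rw [← Real.rpow_natCast _ l]
          exact mul_le_mul_of_nonneg_right
            (Real.rpow_le_rpow_of_exponent_ge (by positivity) h3 hlη.le) hδ.le
      _ = δ * ((1 / (2 * L₂ + 1)) ^ l * (b / c) ^ l * Λ ^ l * (l : ℝ) ^ l) := by
          rw [mul_pow, mul_pow, mul_pow]; ring
      _ ≤ _ := by
          have e1 := pow_le_of_le_one hρ0.le hρ (by omega : l ≠ 0)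
          have e2 := pow_le_pow_of_le_one hβ0.le hβ hl
          have e3 := pow_le_pow_of_le_one hΛ.le hΛ1 hl
          gcongr
  have hLρ : L₂ * (1 / (2 * L₂ + 1)) ≤ 1 := by
    rw [mul_one_div, div_le_one (by positivity)]
    linarith
  -- After squaring, half of the powers of `b/c` and `Λ` cancel the weight bound's `(c/b)^d` and
  -- `Λ^(-d)`; the other half absorbs the growth in `l` and `d`.
  have hY : (b / c) ^ d * Λ ^ d * (l : ℝ) ^ l * W ≤ 1 := by
    refine le_of_sq_le_sq ?_ zero_le_one
    have hβ : (b / c) ^ d ≤ 1 := pow_le_one₀ (by positivity) ((div_le_one hc).2 hbc)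
    calc ((b / c) ^ d * Λ ^ d * (l : ℝ) ^ l * W) ^ 2
        = ((b / c) ^ d * Λ ^ d * (l : ℝ) ^ l) ^ 2 * W ^ 2 := by ring
      _ ≤ ((b / c) ^ d * Λ ^ d * (l : ℝ) ^ l) ^ 2 *
          ((3 * c) ^ d * ((m * h / b * ((l : ℝ) + 1) ^ (2 * l + 1)) ^ d)) := by gcongr
      _ = (b / c) ^ d * (Λ ^ d * ((l : ℝ) ^ (2 * l) * (12 * l * (3 * Real.exp 1) ^ d) ^ d
          * ((l : ℝ) + 1) ^ ((2 * l + 1) * d))) := by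
          rw [hmh, mul_pow (_ / b), pow_mul (l + 1 : ℝ), div_pow, div_pow, div_pow,
            mul_pow 3 c, mul_pow (12 * (l : ℝ)), mul_pow (4 * (l : ℝ)), mul_pow 12,
            mul_pow 4, show (12 : ℝ) = 3 * 4 by norm_num, mul_pow 3 (4 : ℝ), pow_mul' (l : ℝ) 2 l]
          field_simp
      _ ≤ 1 * 1 := mul_le_mul hβ hgrow (by positivity) zero_le_one
      _ = 1 ^ 2 := by norm_num
  calc L₂ * (d * h) ^ η * W
      ≤ L₂ * (δ * (1 / (2 * L₂ + 1) * (b / c) ^ d * Λ ^ d * (l : ℝ) ^ l)) * W := by gcongr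
    _ = δ * ((L₂ * (1 / (2 * L₂ + 1))) * ((b / c) ^ d * Λ ^ d * (l : ℝ) ^ l * W)) := by ring
    _ ≤ δ * (1 * 1) := by gcongr
    _ = δ := by ring

end InterpolationError

end LPIGD

/-! ### The main theorem -/

theorem proposition2
    (μ L₁ M : ℝ) (hμ : 0 < μ) (hσ : 1 < L₁ / μ) (hM : 0 ≤ M) :
    ∃ C₁ C₂ : ℝ, 0 < C₁ ∧ 0 < C₂ ∧
      ∀ (n d p : ℕ), 1 ≤ n → 1 ≤ p → 19 ≤ d →
      ∀ (L₂ η : ℝ), 0 < L₂ → 0 < η → d ≤ LPIGD.order η →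
      ∀ (b c : ℝ), 0 < b → b ≤ c → ∀ (K : ℝ → ℝ), LPIGD.IsKernel K b c →
      ∀ (f : (Fin d → ℝ) → EuclideanSpace ℝ (Fin p) → ℝ), LPIGD.LossAssumptions f L₁ L₂ η μ →
      ∀ (x : Fin n → Fin d → ℝ),
        (∀ j i, x j i ∈ Set.Icc (LPIGD.margin d η L₂ b c) (1 - LPIGD.margin d η L₂ b c)) →
      ∀ (θ₀ : EuclideanSpace ℝ (Fin p)) (ε : ℝ), 0 < ε →
      ∀ (gap : ℝ), gap = LPIGD.erm f x θ₀ - LPIGD.ermInf f x →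
      ∀ (T : ℕ), T = LPIGD.numIter p μ L₁ gap ε →
      ∀ (δ : ℝ), δ = LPIGD.approxError (L₁ / μ) T →
        -- the infimum of the objective is finite
        BddBelow (Set.range (LPIGD.erm f x)) ∧
        -- the output of LPI-GD after `T` iterations is an `ε`-approximate solution
        LPIGD.erm f x
            (LPIGD.lpigd (LPIGD.oracle f) x K L₁ L₂ η b c (fun _ => δ) θ₀ T)
          - LPIGD.ermInf f x ≤ ε ∧
        -- the choices of `T` and `δ` are admissible, and `δ ^ 2 = Θ(ε / p)`
        δ ^ 2 = (1 - 1 / (L₁ / μ)) ^ T ∧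
        (ε < gap + p / (2 * μ) →
          1 ≤ T ∧ δ ∈ Set.Ioo (0 : ℝ) 1 ∧ δ ^ 2 ≤ C₂ * (ε / p) ∧
          (gap ≤ M * p → C₁ * (ε / p) ≤ δ ^ 2)) := by
  obtain ⟨hr0, hr1⟩ := LPIGD.contraction_mem hσ
  -- Both constants come from `r ε ≤ δ² (gap + p/(2μ)) ≤ ε`: `C₂` by dropping `gap ≥ 0`, `C₁` by
  -- inserting `gap ≤ M p`.
  refine ⟨(1 - 1 / (L₁ / μ)) / (M + 1 / (2 * μ)), 2 * μ, by positivity, by positivity, ?_⟩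
  intro n d p hn hp hd L₂ η hL₂ hη hl b c hb hbc K hK f hf x hx θ₀ ε hε gap hgap T hT δ hδ
  have hmg := LPIGD.margin_pos (by omega : 1 ≤ d) hl hL₂ hb (hb.trans_le hbc)
  have hxc : ∀ j, x j ∈ LPIGD.cube d := fun j =>
    ⟨fun i => hmg.le.trans (hx j i).1, fun i => (hx j i).2.trans (by simpa using hmg.le)⟩
  have hbdd := LPIGD.bddBelow_erm hμ hn hf hxc
  have hp' : (0 : ℝ) < p := by exact_mod_cast hp
  have hgap0 : 0 ≤ gap := by
    rw [hgap]
    exact sub_nonneg.2 (ciInf_le hbdd θ₀)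
  have hsum : 0 < gap + p / (2 * μ) := by positivity
  have hδT : δ ^ 2 = (1 - 1 / (L₁ / μ)) ^ T := by rw [hδ, LPIGD.approxError_sq hσ]
  have hδ0 : 0 < δ := by rw [hδ]; exact Real.rpow_pos_of_pos hr0 _
  -- The case `T = 0`, `δ = 1` is included, so the first claim needs no upper bound on `ε`.
  have hδ1 : δ ≤ 1 := by rw [hδ]; exact Real.rpow_le_one hr0.le hr1.le (by positivity)
  have hTε : δ ^ 2 * (gap + p / (2 * μ)) ≤ ε := by
    rw [hδT, hT]
    exact LPIGD.pow_numIter_mul_le hσ hε hsum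
  refine ⟨hbdd, ?_, hδT, fun hεg => ⟨?_, ?_, ?_, fun hgM => ?_⟩⟩
  · refine (LPIGD.lpigd_error_le hμ hσ hn hf hxc (fun θ i j => LPIGD.interpolation_error_le hd hη
      hl hL₂ hb hbc hK hδ0 hδ1 (hx j) (hf.holder_in_data θ i)) θ₀ T).trans ?_
    rw [← hgap, ← hδT]
    linarith
  · rw [hT]
    exact LPIGD.one_le_numIter hσ hε hεg
  · rw [hδ]
    refine LPIGD.approxError_mem_Ioo hσ ?_
    rw [hT]
    exact LPIGD.one_le_numIter hσ hε hεg
  · have h1 : δ ^ 2 * (p / (2 * μ)) ≤ ε :=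
      (mul_le_mul_of_nonneg_left (by linarith) (sq_nonneg δ)).trans hTε
    rw [mul_div_assoc', le_div_iff₀ hp']
    rw [mul_div_assoc', div_le_iff₀ (by positivity)] at h1
    linarith
  · have h1 := LPIGD.le_pow_numIter_mul hσ hε hεg
    rw [← hT, ← hδT] at h1
    have h2 : gap + p / (2 * μ) ≤ (M + 1 / (2 * μ)) * p := by
      rw [add_mul, one_div_mul_eq_div]
      linarith
    have h3 := h1.trans (mul_le_mul_of_nonneg_left h2 (sq_nonneg δ))
    rw [div_mul_div_comm, div_le_iff₀ (by positivity)]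
    exact h3
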